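/- **Setting.** Let $Y_4$ be the toric surface over $\mathbb{Q}$ obtained by blowing up $\mathbb{P}^1\times\mathbb{P}^1$ (coordinates $[x:y]\times[s:t]$) at its four torus-fixed points, and put $w=y/x$, $z=t/s$ on the open orbit. Let $Q=[1:1]\times[1:1]$, let $\varrho(w,z)=(w-1,z-1)\in T_QY_4(\mathbb{R})=\mathbb{R}^2$ be the chart of the open orbit at $Q$, endow $\mathbb{R}^2$ with the maximum norm, and put $d(P)=\|\varrho(P)\|$. For a rational point $P=[x:y]\times[s:t]$ of the open orbit, with $\gcd(x,y)=\gcd(s,t)=1$, let $$H(P)=\frac{\max(|x^2st|,|y^2st|,|t^2xy|,|s^2xy|)}{\gcd(x,s)\gcd(x,t)\gcd(y,s)\gcd(y,t)}$$ be its anticanonical height. For $A\subseteq Y_4$, $r>0$, $B>0$ let $\delta_{A,B,r}=\sum_{P}\delta_{B^{1/r}\varrho(P)}$, a sum of Dirac masses over the rational points $P$ of $A$ in the open orbit with $H(P)\le B$. Let $\chi(\varepsilon)$ and $\chi(\eta,\varepsilon)$ be the characteristic functions of $\{\|v\|\le\varepsilon\}$ and $\{\eta<\|v\|\le\varepsilon\}$.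 The approximation constant $\alpha(Q,A)$ is the infimum of the $\gamma>0$ for which there are rational points $y_i\ne Q$ of $A$ tending to $Q$ with $d(y_i)^\gamma H(y_i)$ bounded, and $\alpha_{\rm ess}(Q)$ is the supremum of $\alpha(Q,U)$ over the dense Zariski open $U\subseteq Y_4$. A proper closed subvariety $W$ is *locally weakly accumulating* if $\alpha(Q,W)=\alpha_{\rm ess}(Q)<\infty$ and if, for every large enough $\varepsilon$ and every dense open $U$ with $\alpha(Q,U)=\alpha_{\rm ess}(Q)$ and $U\cap W$ dense in $W$, one has $\delta_{U\setminus W,B,\alpha_{\rm ess}(Q)}(\chi(\varepsilon))=o\big(\delta_{U\cap W,B,\alpha_{\rm ess}(Q)}(\chi(\varepsilon))\big)$ as $B\to\infty$. A *limit measure* of the zoom of factor $r$ on $A$ is a nonzero locally finite measure $\mu$ on $\mathbb{R}^2$ such that for some $\gamma,\beta\ge0$ one has $B^{-\gamma}(\log B)^{-\beta}\int f\,d\delta_{A,B,r}\to\int f\,d\mu$ as $B\to\infty$ for every continuous $f$ with compact support. Let $Z_1,\dots,Z_4\subset Y_4$ be the strict transforms of $x=y$, $s=t$, $xs=yt$,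 $xt=ys$, let $U_0=Y_4\setminus\bigcup_iZ_i$, and let $V\subset U_0$ be the region $z>w>1$ of the real locus of the open orbit. For coprime integers $0<a<b$ the part in $V$ of the nodal curve $C_{a,b}:aw(z-1)^2=bz(w-1)^2$ is parametrized by $$\psi_{a,b}([u:v])=(w,z)=\Big(\frac{bv(u-v)}{u(bv-ua)},\frac{ua(u-v)}{v(bv-ua)}\Big),\qquad \sqrt{b/a}<u/v<b/a,$$ and $E(a,b,\varepsilon,B,r)$ denotes the set of $[u:v]\in\mathbb{P}^1(\mathbb{Q})$ with $$\sqrt{\tfrac ba}<\tfrac uv<\tfrac ba,\qquad B^{1/r}\,\frac{\frac{u^2}{v^2}-\frac ba}{\frac ba-\frac uv}\le\varepsilon,\qquad H(\psi_{a,b}([u:v]))\le B.$$ **Theorem.** One has $\alpha_{\rm ess}(Q)=2$, so that the zoom of factor $r=2$ is critical, and: 1. For every $\varepsilon>0$ there are constants $C$, $B_0$ such that for all $B\ge B_0$ $$\delta_{V,B,2}(\chi(\varepsilon))=\sum_{\substack{a<b\le\varepsilon^2,\ \gcd(a,b)=1\\ a,b\text{ not both squares}}}\sharp E(a,b,\varepsilon,B,2)\le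 C,\qquad \delta_{U_0,B,2}(\chi(\varepsilon))\le C.$$ 2. The subvariety $\bigcup_{i=1}^4Z_i$ is locally weakly accumulating, and it is contained in every locally weakly accumulating subvariety of $Y_4$. 3. For $A=V$ and for $A=U_0$ there is no limit measure for the zoom of factor $2$ on $A$; moreover there are $0<\eta<\varepsilon$ with $$\liminf_{B\to\infty}\delta_{A,B,2}(\chi(\eta,\varepsilon))=0<1\le\limsup_{B\to\infty}\delta_{A,B,2}(\chi(\eta,\varepsilon))<\infty.$$ -/

import Mathlib

open Filter Topology MeasureTheory
open scoped NNReal ENNReal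

/-- `v` is a system of homogeneous coordinates of the point `P` of `(ℙ¹)⁴`. -/
def IsCoords (P : Fin 4 → Projectivization ℂ (Fin 2 → ℂ)) (v : Fin 4 → Fin 2 → ℂ) : Prop :=
  ∀ i, ∃ h : v i ≠ 0, Projectivization.mk ℂ (v i) h = P i

/-- The complex points of the surface `Y₄`, the blow-up of `ℙ¹ × ℙ¹` at its four torus-fixed
points. With coordinates `([x:y], [s:t], [p:q], [m:n])` on `(ℙ¹)⁴` it is the subvariety
`q x s = p y t`, `n x t = m y s`; the blow-down map is the projection to `([x:y], [s:t])`.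
The ideal `(xs, yt)` defines (reduced) two of the fixed points, the ideal `(xt, ys)` the other
two, and `[p:q]`, `[m:n]` are the coordinates of the blow-ups of these ideals. -/
def Y4 : Type :=
  {P : Fin 4 → Projectivization ℂ (Fin 2 → ℂ) //
    ∀ v, IsCoords P v →
      v 2 1 * v 0 0 * v 1 0 = v 2 0 * v 0 1 * v 1 1 ∧
      v 3 1 * v 0 0 * v 1 1 = v 3 0 * v 0 1 * v 1 0}

/-- The point `[1:c]` of `ℙ¹`. -/
noncomputable def affinePoint (c : ℂ) : Projectivization ℂ (Fin 2 → ℂ) :=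
  Projectivization.mk ℂ ![1, c] (fun h => one_ne_zero (congrFun h 0))

/-- The points of the open orbit of `Y₄`: `(w, z)` is the point lying over `[1:w] × [1:z]`, for
`w = y/x`, `z = t/s` nonzero elements of a subfield `K` of `ℂ`. -/
noncomputable def orbitPoint {K : Type} [Field K] [Algebra K ℂ] (P : Kˣ × Kˣ) : Y4 :=
  let w : ℂ := algebraMap K ℂ P.1
  let z : ℂ := algebraMap K ℂ P.2
  ⟨fun i => affinePoint (![w, z, w * z, w / z] i), by
    intro v hv
    have hz : z ≠ 0 := by
      simp [z]
    have key : ∀ i, v i 1 = ![w, z, w * z, w / z] i * v i 0 := by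
      intro i
      obtain ⟨h, e⟩ := hv i
      obtain ⟨c, hc⟩ := (Projectivization.mk_eq_mk_iff _ _ _ _ _).1 e
      have h0 := congrFun hc 0
      have h1 := congrFun hc 1
      simp only [Units.smul_def, Pi.smul_apply, smul_eq_mul, Matrix.cons_val_zero,
        Matrix.cons_val_one] at h0 h1
      rw [← h0, ← h1]
      ring
    have k0 := key 0
    have k1 := key 1
    have k2 := key 2
    have k3 := key 3
    simp only [Matrix.cons_val] at k0 k1 k2 k3
    rw [k0, k1, k2, k3]
    constructor
    · ring
    · field_simp⟩

/-! ### The Zariski topology of the `ℚ`-variety `Y₄` -/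

/-- Polynomials over `ℚ` in the eight coordinates of `(ℙ¹)⁴` that are homogeneous in each of the
four pairs of variables. -/
def IsMultihomogeneous (f : MvPolynomial (Fin 4 × Fin 2) ℚ) : Prop :=
  ∃ d : Fin 4 → ℕ,
    MvPolynomial.IsWeightedHomogeneous
      (fun k : Fin 4 × Fin 2 => (Pi.single k.1 1 : Fin 4 → ℕ)) f d

/-- The common zeros in `Y₄` of a set of multihomogeneous polynomials. -/
def zeroLocus (S : Set (MvPolynomial (Fin 4 × Fin 2) ℚ)) : Set Y4 :=
  {P | ∀ f ∈ S, ∀ v, IsCoords P.1 v →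
    MvPolynomial.aeval (fun k : Fin 4 × Fin 2 => v k.1 k.2) f = 0}

def IsZariskiClosed (W : Set Y4) : Prop :=
  ∃ S : Set (MvPolynomial (Fin 4 × Fin 2) ℚ),
    (∀ f ∈ S, IsMultihomogeneous f) ∧ W = zeroLocus S

def IsZariskiOpen (U : Set Y4) : Prop := IsZariskiClosed Uᶜ

/-- The subset `A` of `W` is Zariski dense in `W`. -/
def IsZariskiDenseIn (A W : Set Y4) : Prop :=
  A ⊆ W ∧ ∀ F, IsZariskiClosed F → A ⊆ F → W ⊆ F

def IsDenseOpen (U : Set Y4) : Prop := IsZariskiOpen U ∧ IsZariskiDenseIn U Set.univ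

/-! ### Height, local chart, approximation constants at the point `Q = (1, 1)` -/

/-- The anticanonical Weil height of the point `[x:y] × [s:t]` of the open orbit, where
`w = y/x` and `z = t/s` are nonzero rational numbers written in lowest terms:
`max(|x²st|, |y²st|, |t²xy|, |s²xy|) / (gcd(x,s) gcd(x,t) gcd(y,s) gcd(y,t))`. -/
noncomputable def anticanonicalHeight (w z : ℚ) : ℝ :=
  let x : ℕ := w.den
  let y : ℕ := w.num.natAbs
  let s : ℕ := z.den
  let t : ℕ := z.num.natAbs
  ((max (max (x ^ 2 * s * t) (y ^ 2 * s * t)) (max (t ^ 2 * x * y) (s ^ 2 * x * y)) : ℕ) : ℝ) /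
    ((x.gcd s * x.gcd t * y.gcd s * y.gcd t : ℕ) : ℝ)

/-- The chart `(w, z) ↦ (w - 1, z - 1)` of the open orbit, with values in the tangent plane
`ℝ²` at `Q`. The norm of `ℝ × ℝ` is the maximum norm. -/
def chart (P : ℚˣ × ℚˣ) : ℝ × ℝ := (((P.1 : ℚ) : ℝ) - 1, ((P.2 : ℚ) : ℝ) - 1)

/-- The approximation constant `α(Q, V)`: the infimum of the `γ > 0` for which there are
rational points `yᵢ ≠ Q` of `V` converging to `Q` with `d(Q, yᵢ)^γ H(yᵢ)` bounded. Sequences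
converging to `Q` are eventually in the open orbit, so only its points are used. The value is
`∞` when there is no such `γ`. -/
noncomputable def approxConst (V : Set Y4) : ℝ≥0∞ :=
  sInf (ENNReal.ofReal '' {γ : ℝ | 0 < γ ∧ ∃ y : ℕ → ℚˣ × ℚˣ, ∃ C : ℝ, 0 < C ∧
    (∀ i, y i ≠ 1 ∧ orbitPoint (y i) ∈ V) ∧
    Tendsto (fun i => ‖chart (y i)‖) atTop (𝓝 0) ∧
    ∀ i, ‖chart (y i)‖ ^ γ * anticanonicalHeight (y i).1 (y i).2 < C})

/-- The essential constant of `Q`: the supremum of `α(Q, U)` over the dense open `U`. -/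
noncomputable def essentialConst : ℝ≥0∞ :=
  ⨆ (U : Set Y4) (_ : IsDenseOpen U), approxConst U

/-! ### Zoom -/

/-- The measure `δ_{A,Q,B,r}` on the tangent plane: the sum of the Dirac masses at
`B^{1/r} ρ(P)` over the rational points `P` of `A`, in the domain of the chart `ρ`, of height at
most `B`. -/
noncomputable def zoomMeasure (A : Set Y4) (B r : ℝ) : Measure (ℝ × ℝ) :=
  Measure.sum fun P : {P : ℚˣ × ℚˣ //
      orbitPoint P ∈ A ∧ anticanonicalHeight P.1 P.2 ≤ B} =>
    Measure.dirac (B ^ (1 / r) • chart P.1)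

/-- The annulus `{y : η < |y| ≤ ε}` of the tangent plane. -/
def annulus (η ε : ℝ) : Set (ℝ × ℝ) := {y | η < ‖y‖ ∧ ‖y‖ ≤ ε}

/-- `μ` is a limit measure of the zoom of factor `r` on `A`: a nonzero locally finite measure
that is, for some `γ, β ≥ 0`, the limit of `δ_{A,Q,B,r} / (B^γ (log B)^β)` as `B → ∞`, tested
against the continuous functions with compact support. -/
def IsLimitMeasure (A : Set Y4) (r : ℝ) (μ : Measure (ℝ × ℝ)) : Prop :=
  μ ≠ 0 ∧ IsLocallyFiniteMeasure μ ∧ ∃ γ β : ℝ, 0 ≤ γ ∧ 0 ≤ β ∧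
    ∀ f : ℝ × ℝ → ℝ, Continuous f → HasCompactSupport f →
      Tendsto (fun B : ℝ => (∫ y, f y ∂(zoomMeasure A B r)) / (B ^ γ * Real.log B ^ β)) atTop
        (𝓝 (∫ y, f y ∂μ))

/-- A proper closed subvariety `W` is locally weakly accumulating at `Q` if `α(Q, W)` equals the
essential constant (supposed finite), and for every large enough `ε` and every dense open `U`
with `α(Q, U)` equal to the essential constant and `U ∩ W` dense in `W`, the number of points
of `U \ W` in the critical zoom of radius `ε` is `o` of that of `U ∩ W` as `B → ∞`. -/
def IsLocallyWeaklyAccumulating (W : Set Y4) : Prop :=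
  IsZariskiClosed W ∧ W ≠ Set.univ ∧ essentialConst < ∞ ∧ approxConst W = essentialConst ∧
  ∃ ε₀ : ℝ, 0 < ε₀ ∧ ∀ ε : ℝ, ε₀ ≤ ε → ∀ U : Set Y4, IsDenseOpen U →
    approxConst U = essentialConst → IsZariskiDenseIn (U ∩ W) W →
      ∀ c : ℝ≥0, 0 < c → ∀ᶠ B : ℝ in atTop,
        zoomMeasure (U \ W) B essentialConst.toReal (Metric.closedBall 0 ε) ≤
          c * zoomMeasure (U ∩ W) B essentialConst.toReal (Metric.closedBall 0 ε)

/-! ### The special curves, the region `z > w > 1`, the nodal curves -/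

/-- The four special curves through `Q`, the strict transforms of `x = y`, `s = t`, `xs = yt`,
`xt = ys` in this order: the fibres over `[1:1]` of the four projections `Y₄ → ℙ¹`, which on the
open orbit are `(w, z) ↦ w, z, wz, w/z`. -/
def specialCurve (i : Fin 4) : Set Y4 := {P | P.1 i = affinePoint 1}

/-- The union of the four special curves. -/
def specialCurves : Set Y4 := ⋃ i, specialCurve i

/-- The set of real points of the open orbit with `z > w > 1`. -/
def regionV : Set Y4 :=
  {P | ∃ T : ℝˣ × ℝˣ, 1 < (T.1 : ℝ) ∧ (T.1 : ℝ) < (T.2 : ℝ) ∧ P = orbitPoint T}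

/-- The set `E(a, b, ε, B, r)`. The nodal curve `C_{a,b} : a w (z-1)² = b z (w-1)²` is
parametrized by the slope `l = (z-1)/(w-1) = u/v` of the line joining a point to `Q`:
`w = b(l-1)/(l(b-la))`, `z = la(l-1)/(b-la)`. The points of `C_{a,b}` with `z > w > 1` are those
with `√(b/a) < l < b/a`, and at them `z - 1 = (l² - b/a)/(b/a - l)`. -/
def nodalParams (a b : ℕ) (ε B r : ℝ) : Set ℚ :=
  {l | √((b : ℝ) / a) < (l : ℝ) ∧ (l : ℝ) < (b : ℝ) / a ∧
    B ^ (1 / r) * (((l : ℝ) ^ 2 - (b : ℝ) / a) / ((b : ℝ) / a - l)) ≤ ε ∧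
    anticanonicalHeight (b * (l - 1) / (l * (b - l * a))) (l * a * (l - 1) / (b - l * a)) ≤ B}

/-- The coprime pairs `0 < a < b ≤ ε²` that do not consist of two squares. -/
def nodalPairs (ε : ℝ) : Set (ℕ × ℕ) :=
  {p | 0 < p.1 ∧ p.1 < p.2 ∧ (p.2 : ℝ) ≤ ε ^ 2 ∧ p.1.Coprime p.2 ∧
    ¬ (IsSquare p.1 ∧ IsSquare p.2)}

/-! Write a point near `Q` in lowest terms as `w = (x + a)/x`, `z = (s + c)/s`. Since numerators and
denominators are coprime, the four gcds in the height multiply to `G = gcd(x(x + a), s(s + c))`.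
With `x(x + a) = pG` and `s(s + c) = qG` (signs being positive near `Q`), the height is the maximum
of `q x²`, `q (x + a)²`, `p s²`, `p (s + c)²`. Comparing `d ≥ |a|/x` with `H ≥ q x²`, or the same
for the other factor, gives `d² H ≥ 1`, so every approximation constant is at least 2. For the
matching bound on a dense open set, take points with `a = c = 1`, `q = 1`, `p = N`: they come from a
Pell equation, lie on the nodal curve `C_{1,N}`, and for suitable `N` enter every dense open set
(`IsDenseOpen.exists_consecRatio`).

In the critical zoom, the height bound and the distance bound together give `q a² ≤ ε²` and `p c² ≤
ε²`. Off the special curves `a` and `c` are nonzero, so `a, c, p, q` take finitely many values.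
Moreover `m = 2x + a`, `n = 2s + c` satisfy `q m² - p n² = q a² - p c²`, whose right side is nonzero
exactly because `wz ≠ 1` and `w ≠ z`. As `n` has order `√B`, each such conic has boundedly many
points in the window (`encard_zoomPoints_compl_le`). A special curve, by contrast, carries on the
order of `√B` points for large `ε`; this comparison yields both statements on weak accumulation.

In `V`, the slope of the line to `Q` and the ratio `b/a` determine a point, which gives the
decomposition along nodal curves. The relation `b q a₀² = a p c²`, with `a₀` the displacement of
`w`, bounds `b`; if `a` and `b` were both squares, the Pell form would split and `n` would be
bounded (`nodal_coefficients`).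

There is no limit measure because solutions of `m² - 2n² = -1` are sparse. Adjusting `√B` to one
solution leaves the ball of radius `3/2` empty (`zoomPoints_eq_empty`), while other values of `B`
put a point close to the norm `√2` (`exists_one_le_zoomMeasure`). Counts are bounded, so a
normalization tending to infinity gives the zero measure and the trivial normalization oscillates.
-/

/-! ### Values of multihomogeneous forms -/

/-- The value of `f` at a system of coordinates in a `ℚ`-algebra. -/
noncomputable def evalAt {R : Type*} [CommRing R] [Algebra ℚ R]
    (f : MvPolynomial (Fin 4 × Fin 2) ℚ) (v : Fin 4 → Fin 2 → R) : R :=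
  MvPolynomial.aeval (fun k : Fin 4 × Fin 2 => v k.1 k.2) f

lemma map_evalAt {R S : Type*} [CommRing R] [Algebra ℚ R] [CommRing S] [Algebra ℚ S]
    (φ : R →ₐ[ℚ] S) (f : MvPolynomial (Fin 4 × Fin 2) ℚ) (v : Fin 4 → Fin 2 → R) :
    φ (evalAt f v) = evalAt f (fun i j => φ (v i j)) :=
  MvPolynomial.comp_aeval_apply _ _ _

lemma evalAt_ratCast (f : MvPolynomial (Fin 4 × Fin 2) ℚ) (v : Fin 4 → Fin 2 → ℚ) :
    evalAt f (fun i j => ((v i j : ℚ) : ℂ)) = ((evalAt f v : ℚ) : ℂ) :=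
  (map_evalAt (Algebra.ofId ℚ ℂ) f v).symm

lemma evalAt_scale {f : MvPolynomial (Fin 4 × Fin 2) ℚ} (hf : IsMultihomogeneous f) :
    ∃ d : Fin 4 → ℕ, ∀ (c : Fin 4 → ℂ) (v : Fin 4 → Fin 2 → ℂ),
      evalAt f (fun i j => c i * v i j) = (∏ i, c i ^ d i) * evalAt f v := by
  obtain ⟨d, hd⟩ := hf
  refine ⟨d, fun c v => ?_⟩
  simp only [evalAt, MvPolynomial.aeval_def, MvPolynomial.eval₂_eq', Finset.mul_sum]
  refine Finset.sum_congr rfl fun m hm => ?_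
  have hw := hd (MvPolynomial.mem_support_iff.1 hm)
  have hm' : ∀ i, d i = ∑ j, m (i, j) := by
    intro i
    rw [← hw, Finsupp.weight_apply, Finsupp.sum_fintype _ _ (by simp), Finset.sum_apply,
      Fintype.sum_prod_type, Finset.sum_eq_single i]
    · simp
    · intro b _ hb
      simp [Ne.symm hb]
    · simp
  have : ∏ k : Fin 4 × Fin 2, c k.1 ^ m k = ∏ i, c i ^ d i := by
    rw [Fintype.prod_prod_type]
    exact Finset.prod_congr rfl fun i _ => by rw [hm', ← Finset.prod_pow_eq_pow_sum]
  simp only [mul_pow, Finset.prod_mul_distrib, this]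
  ring

/-- Rescaling the four pairs multiplies a form by a nonzero monomial in the scalars, so membership
in a closed set can be tested on the most convenient coordinates. -/
lemma evalAt_eq_zero_iff_of_isCoords {f : MvPolynomial (Fin 4 × Fin 2) ℚ}
    (hf : IsMultihomogeneous f) {P : Fin 4 → Projectivization ℂ (Fin 2 → ℂ)}
    {v v' : Fin 4 → Fin 2 → ℂ} (hv : IsCoords P v) (hv' : IsCoords P v') :
    evalAt f v = 0 ↔ evalAt f v' = 0 := by
  have : ∀ i, ∃ c : ℂ, c ≠ 0 ∧ ∀ j, v i j = c * v' i j := by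
    intro i
    obtain ⟨h, e⟩ := hv i
    obtain ⟨h', e'⟩ := hv' i
    obtain ⟨c, hc⟩ := (Projectivization.mk_eq_mk_iff _ _ _ h h').1 (e.trans e'.symm)
    exact ⟨c, c.ne_zero, fun j => by rw [← hc]; rfl⟩
  choose c hc hcv using this
  obtain ⟨d, hd⟩ := evalAt_scale hf
  have : v = fun i j => c i * v' i j := by
    funext i j
    exact hcv i j
  rw [this, hd]
  simp [Finset.prod_eq_zero_iff, hc]

lemma mem_zeroLocus_iff {S : Set (MvPolynomial (Fin 4 × Fin 2) ℚ)}
    (hS : ∀ f ∈ S, IsMultihomogeneous f) {P : Y4} {v : Fin 4 → Fin 2 → ℂ}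
    (hv : IsCoords P.1 v) : P ∈ zeroLocus S ↔ ∀ f ∈ S, evalAt f v = 0 :=
  ⟨fun h f hf => h f hf v hv, fun h f hf _ hv' =>
    (evalAt_eq_zero_iff_of_isCoords (hS f hf) hv hv').1 (h f hf)⟩

lemma exists_isCoords (P : Fin 4 → Projectivization ℂ (Fin 2 → ℂ)) : ∃ v, IsCoords P v :=
  ⟨fun i => (P i).rep, fun i => ⟨(P i).rep_nonzero, (P i).mk_rep⟩⟩

lemma ne_zero_or_ne_zero {v : Fin 2 → ℂ} (h : v ≠ 0) : v 0 ≠ 0 ∨ v 1 ≠ 0 := by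
  by_contra! hc
  exact h (funext fun j => by fin_cases j <;> simp [hc.1, hc.2])

lemma mk_eq_mk_of_cross {v v' : Fin 2 → ℂ} (h : v ≠ 0) (h' : v' ≠ 0)
    (hc : v 0 * v' 1 = v 1 * v' 0) :
    Projectivization.mk ℂ v' h' = Projectivization.mk ℂ v h := by
  rw [Projectivization.mk_eq_mk_iff']
  rcases ne_zero_or_ne_zero h with h0 | h1
  · refine ⟨v' 0 / v 0, funext fun j => ?_⟩
    fin_cases j
    · simp [h0]
    · simp only [Pi.smul_apply, smul_eq_mul, Fin.mk_one]
      field_simp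
      linear_combination -hc
  · refine ⟨v' 1 / v 1, funext fun j => ?_⟩
    fin_cases j
    · simp only [Pi.smul_apply, smul_eq_mul, Fin.zero_eta]
      field_simp
      linear_combination hc
    · simp [h1]

lemma isCoords_of_cross {P : Fin 4 → Projectivization ℂ (Fin 2 → ℂ)} {v v' : Fin 4 → Fin 2 → ℂ}
    (hv : IsCoords P v) (h : ∀ i, v' i ≠ 0) (hc : ∀ i, v i 0 * v' i 1 = v i 1 * v' i 0) :
    IsCoords P v' := fun i => by
  obtain ⟨h', e⟩ := hv i
  exact ⟨h i, by rw [← e, mk_eq_mk_of_cross h' (h i) (hc i)]⟩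

lemma eq_affinePoint_iff {P : Projectivization ℂ (Fin 2 → ℂ)} {v : Fin 2 → ℂ} (h : v ≠ 0)
    (e : Projectivization.mk ℂ v h = P) (c : ℂ) : P = affinePoint c ↔ v 1 = c * v 0 := by
  constructor
  · intro hP
    rw [hP, affinePoint, Projectivization.mk_eq_mk_iff'] at e
    obtain ⟨a, ha⟩ := e
    rw [← ha]
    simp [mul_comm]
  · intro hv
    rw [← e, affinePoint]
    exact mk_eq_mk_of_cross _ h (by simp [hv])

lemma affinePoint_injective : Function.Injective affinePoint := fun c c' h => by
  have := (eq_affinePoint_iff _ rfl c').1 h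
  simpa using this

/-- Homogeneous coordinates of the point `(w, z)` of the open orbit. -/
def orbitCoords {R : Type*} [CommRing R] (w z : R) : Fin 4 → Fin 2 → R :=
  ![![1, w], ![1, z], ![1, w * z], ![z, w]]

lemma isCoords_orbitPoint {K : Type} [Field K] [Algebra K ℂ] (P : Kˣ × Kˣ) :
    IsCoords (orbitPoint P).1
      (orbitCoords (algebraMap K ℂ P.1) (algebraMap K ℂ P.2)) := by
  have hz : algebraMap K ℂ P.2 ≠ 0 := by simp
  intro i
  have hne : orbitCoords (algebraMap K ℂ P.1) (algebraMap K ℂ P.2) i ≠ 0 := by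
    intro h0
    have h0 := congrFun h0 0
    fin_cases i <;> simp [orbitCoords] at h0
  refine ⟨hne, ((eq_affinePoint_iff hne rfl _).2 ?_)⟩
  fin_cases i <;> simp [orbitCoords]

lemma orbitCoords_ratCast (w z : ℚ) :
    orbitCoords (w : ℂ) (z : ℂ) = fun i j => ((orbitCoords w z i j : ℚ) : ℂ) := by
  funext i j
  fin_cases i <;> fin_cases j <;> simp [orbitCoords]

lemma orbitPoint_mem_specialCurve_iff (P : ℚˣ × ℚˣ) (i : Fin 4) :
    orbitPoint P ∈ specialCurve i ↔
      ![(P.1 : ℚ), P.2, P.1 * P.2, P.1 / P.2] i = 1 := by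
  have : orbitPoint P ∈ specialCurve i ↔
      affinePoint (![((P.1 : ℚ) : ℂ), ((P.2 : ℚ) : ℂ), ((P.1 : ℚ) : ℂ) * ((P.2 : ℚ) : ℂ),
        ((P.1 : ℚ) : ℂ) / ((P.2 : ℚ) : ℂ)] i) = affinePoint 1 := Iff.rfl
  rw [this, affinePoint_injective.eq_iff]
  fin_cases i <;> simp <;> norm_cast
  all_goals exact Units.val_eq_one

lemma orbitPoint_mem_specialCurves_iff (P : ℚˣ × ℚˣ) :
    orbitPoint P ∈ specialCurves ↔
      (P.1 : ℚ) = 1 ∨ (P.2 : ℚ) = 1 ∨ (P.1 : ℚ) * P.2 = 1 ∨ (P.1 : ℚ) = P.2 := by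
  simp only [specialCurves, Set.mem_iUnion, orbitPoint_mem_specialCurve_iff, Fin.exists_fin_succ,
    IsEmpty.exists_iff, or_false]
  have : (P.1 : ℚ) / P.2 = 1 ↔ (P.1 : ℚ) = P.2 := div_eq_one_iff_eq P.2.ne_zero
  simpa using by tauto

lemma orbitPoint_mem_regionV_iff (P : ℚˣ × ℚˣ) :
    orbitPoint P ∈ regionV ↔ (1 : ℚ) < P.1 ∧ (P.1 : ℚ) < P.2 := by
  constructor
  · rintro ⟨T, h1, h2, h⟩
    have h0 : affinePoint ((P.1 : ℚ) : ℂ) = affinePoint ((T.1 : ℝ) : ℂ) :=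
      congrFun (congrArg Subtype.val h) 0
    have h0' : affinePoint ((P.2 : ℚ) : ℂ) = affinePoint ((T.2 : ℝ) : ℂ) :=
      congrFun (congrArg Subtype.val h) 1
    have e1 : ((P.1 : ℚ) : ℝ) = T.1 := by exact_mod_cast affinePoint_injective h0
    have e2 : ((P.2 : ℚ) : ℝ) = T.2 := by exact_mod_cast affinePoint_injective h0'
    rw [← e1] at h1 h2
    rw [← e2] at h2
    exact ⟨by exact_mod_cast h1, by exact_mod_cast h2⟩
  · rintro ⟨h1, h2⟩
    refine ⟨⟨Units.map (algebraMap ℚ ℝ) P.1, Units.map (algebraMap ℚ ℝ) P.2⟩, ?_, ?_, ?_⟩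
    · simpa using mod_cast h1
    · simpa using h2
    · apply Subtype.ext
      funext i
      simp [orbitPoint]

/-! ### Closed subsets and special curves -/

lemma finite_zeros_evalAt {f : MvPolynomial (Fin 4 × Fin 2) ℚ}
    (φ : Fin 4 → Fin 2 → Polynomial ℚ) (L₀ : ℚ)
    (h : evalAt f (fun i j => (φ i j).eval L₀) ≠ 0) :
    {L : ℚ | evalAt f (fun i j => (φ i j).eval L) = 0}.Finite := by
  have key : ∀ L : ℚ, (evalAt f φ).eval L = evalAt f (fun i j => (φ i j).eval L) := fun L => by
    have := map_evalAt (Polynomial.aeval L) f φ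
    simpa [Polynomial.coe_aeval_eq_eval] using this
  have hne : evalAt f φ ≠ 0 := fun h0 => h (by rw [← key, h0, Polynomial.eval_zero])
  refine (Polynomial.finite_setOfPred_isRoot hne).subset fun L hL => ?_
  exact (key L).trans hL

/-- Homogeneous coordinates of the point of the `i`-th special curve with parameter `[u:v]`. -/
def specialCoords {R : Type*} [CommRing R] (i : Fin 4) (u v : R) : Fin 4 → Fin 2 → R :=
  ![![![1, 1], ![u, v], ![u, v], ![v, u]],
    ![![u, v], ![1, 1], ![u, v], ![u, v]],
    ![![u, v], ![v, u], ![1, 1], ![u ^ 2, v ^ 2]],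
    ![![u, v], ![u, v], ![u ^ 2, v ^ 2], ![1, 1]]] i

lemma map_specialCoords {R S : Type*} [CommRing R] [Algebra ℚ R] [CommRing S] [Algebra ℚ S]
    (φ : R →ₐ[ℚ] S) (i : Fin 4) (u v : R) : (fun k j => φ (specialCoords i u v k j)) = specialCoords i (φ u) (φ v) := by
  funext k j
  fin_cases i <;> fin_cases k <;> fin_cases j <;> simp [specialCoords]

lemma specialCoords_ne_zero (i : Fin 4) {u v : ℂ} (h : u ≠ 0 ∨ v ≠ 0) (k : Fin 4) :
    specialCoords i u v k ≠ 0 := by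
  intro h'
  have h0 := congrFun h' 0
  have h1 := congrFun h' 1
  fin_cases i <;> fin_cases k <;> simp [specialCoords] at h0 h1 <;> simp_all

/-- On the fibre the equations of `Y4` tie all pairs to one free pair. For the last two curves one
other pair is quadratic in the parameter. -/
lemma exists_specialCoords {P : Y4} {i : Fin 4} (hP : P ∈ specialCurve i) :
    ∃ u v : ℂ, (u ≠ 0 ∨ v ≠ 0) ∧ IsCoords P.1 (specialCoords i u v) := by
  obtain ⟨c, hc⟩ := exists_isCoords P.1
  obtain ⟨e1, e2⟩ := P.2 c hc
  have hne : ∀ k, c k 0 ≠ 0 ∨ c k 1 ≠ 0 := fun k => ne_zero_or_ne_zero (hc k).1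
  have hi : c i 1 = c i 0 := by
    simpa using (eq_affinePoint_iff (hc i).1 (hc i).2 1).1 hP
  have hi0 : c i 0 ≠ 0 := by
    rcases hne i with h | h
    · exact h
    · rwa [hi] at h
  have main : ∃ u v : ℂ, (u ≠ 0 ∨ v ≠ 0) ∧
      ∀ k, c k 0 * specialCoords i u v k 1 = c k 1 * specialCoords i u v k 0 := by
    fin_cases i <;> simp only [Fin.zero_eta, Fin.mk_one, Fin.reduceFinMk] at hi hi0
    · refine ⟨c 1 0, c 1 1, hne 1, fun k => ?_⟩
      fin_cases k <;> simp [specialCoords, hi]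
      · ring
      · exact mul_left_cancel₀ hi0 (by rw [hi] at e1; linear_combination -e1)
      · exact mul_left_cancel₀ hi0 (by rw [hi] at e2; linear_combination -e2)
    · refine ⟨c 0 0, c 0 1, hne 0, fun k => ?_⟩
      fin_cases k <;> simp [specialCoords, hi]
      · ring
      · exact mul_left_cancel₀ hi0 (by rw [hi] at e1; linear_combination -e1)
      · exact mul_left_cancel₀ hi0 (by rw [hi] at e2; linear_combination -e2)
    · have h10 : c 0 0 * c 1 0 = c 0 1 * c 1 1 :=
        mul_left_cancel₀ hi0 (by rw [hi] at e1; linear_combination e1)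
      refine ⟨c 0 0, c 0 1, hne 0, fun k => ?_⟩
      fin_cases k <;> simp [specialCoords, hi]
      · ring
      · linear_combination h10
      -- The equation has to be divided by a coordinate of `[s:t]`, and only one of the two is known
      -- to be nonzero.
      · rcases hne 1 with h | h
        · apply mul_left_cancel₀ h
          linear_combination (-c 0 0 * c 3 1 ) * h10 - c 0 1 * e2
        · apply mul_left_cancel₀ h
          linear_combination (-c 3 0 * c 0 1) * h10 - c 0 0 * e2
    · have h10 : c 0 0 * c 1 1 = c 0 1 * c 1 0 :=
        mul_left_cancel₀ hi0 (by rw [hi] at e2; linear_combination e2)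
      refine ⟨c 0 0, c 0 1, hne 0, fun k => ?_⟩
      fin_cases k <;> simp [specialCoords, hi]
      · ring
      · linear_combination -h10
      · rcases hne 1 with h | h
        · apply mul_left_cancel₀ h
          linear_combination (-c 2 0 * c 0 1) * h10 - c 0 0 * e1
        · apply mul_left_cancel₀ h
          linear_combination (-c 2 1 * c 0 0) * h10 - c 0 1 * e1
  obtain ⟨u, v, huv, h⟩ := main
  exact ⟨u, v, huv, isCoords_of_cross hc (specialCoords_ne_zero i huv) h⟩

lemma evalAt_specialCoords_eq_zero_iff {f : MvPolynomial (Fin 4 × Fin 2) ℚ}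
    (hf : IsMultihomogeneous f) (i : Fin 4) {a b a' b' : ℂ} (h : a ≠ 0 ∨ b ≠ 0)
    (h' : a' ≠ 0 ∨ b' ≠ 0) (hc : a * b' = b * a') :
    evalAt f (specialCoords i a b) = 0 ↔ evalAt f (specialCoords i a' b') = 0 := by
  have h1 : IsCoords (fun k => Projectivization.mk ℂ _ (specialCoords_ne_zero i h k))
      (specialCoords i a b) := fun k => ⟨specialCoords_ne_zero i h k, rfl⟩
  refine evalAt_eq_zero_iff_of_isCoords hf h1
    (isCoords_of_cross h1 (specialCoords_ne_zero i h') fun k => ?_)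
  have hc2 : a ^ 2 * b' ^ 2 = b ^ 2 * a' ^ 2 := by rw [← mul_pow, hc, mul_pow]
  fin_cases i <;> fin_cases k <;> simp [specialCoords] <;>
    first | exact hc | exact hc.symm | exact hc2

lemma isMultihomogeneous_X (k : Fin 4 × Fin 2) : MvPolynomial.IsWeightedHomogeneous
    (fun k : Fin 4 × Fin 2 => (Pi.single k.1 1 : Fin 4 → ℕ)) (MvPolynomial.X k : MvPolynomial _ ℚ)
    (Pi.single k.1 1) :=
  MvPolynomial.isWeightedHomogeneous_X ℚ _ k

lemma isZariskiClosed_iUnion_specialCurve (T : Finset (Fin 4)) :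
    IsZariskiClosed (⋃ i ∈ T, specialCurve i) := by
  set f : MvPolynomial (Fin 4 × Fin 2) ℚ :=
    ∏ i ∈ T, (MvPolynomial.X (i, 1) - MvPolynomial.X (i, 0)) with hf
  have hS : ∀ g ∈ ({f} : Set _), IsMultihomogeneous g := by
    rintro g rfl
    refine ⟨∑ i ∈ T, Pi.single i 1, MvPolynomial.IsWeightedHomogeneous.prod _ _ _ fun i _ => ?_⟩
    have h1 := isMultihomogeneous_X (i, 1)
    have h0 := isMultihomogeneous_X (i, 0)
    exact (MvPolynomial.weightedHomogeneousSubmodule ℚ _ _).sub_mem h1 h0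
  refine ⟨{f}, hS, ?_⟩
  ext P
  obtain ⟨v, hv⟩ := exists_isCoords P.1
  rw [mem_zeroLocus_iff hS hv]
  simp only [Set.mem_iUnion, Set.mem_singleton_iff, forall_eq, hf, evalAt, map_prod, map_sub,
    MvPolynomial.aeval_X, Finset.prod_eq_zero_iff, sub_eq_zero, exists_prop]
  refine exists_congr fun i => and_congr_right fun _ => ?_
  have := eq_affinePoint_iff (hv i).1 (hv i).2 1
  rw [one_mul] at this
  exact this

lemma isZariskiClosed_specialCurves : IsZariskiClosed specialCurves := by
  simpa [specialCurves] using isZariskiClosed_iUnion_specialCurve Finset.univ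

lemma isDenseOpen_univ : IsDenseOpen Set.univ := by
  refine ⟨⟨{1}, ?_, ?_⟩, subset_rfl, fun F _ h => h⟩
  · rintro f rfl
    exact ⟨0, MvPolynomial.isWeightedHomogeneous_one ℚ _⟩
  · ext P
    obtain ⟨v, hv⟩ := exists_isCoords P.1
    simp only [Set.compl_univ, Set.mem_empty_iff_false, false_iff]
    intro h
    simpa using h 1 rfl v hv

/-- A closed set that contains infinitely many of the points `[n:n+1]` of a special curve contains
the curve. -/
lemma specialCurve_subset_of_infinite {W : Set Y4} (hW : IsZariskiClosed W) (i : Fin 4)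
    (p : ℕ → ℚˣ × ℚˣ)
    (hp : ∀ n, IsCoords (orbitPoint (p n)).1 (specialCoords i ((n : ℂ) + 1) ((n : ℂ) + 2)))
    (hinf : {n | orbitPoint (p n) ∈ W}.Infinite) : specialCurve i ⊆ W := by
  obtain ⟨S, hS, rfl⟩ := hW
  intro P hP
  obtain ⟨u, v, huv, hc⟩ := exists_specialCoords hP
  rw [mem_zeroLocus_iff hS hc]
  intro f hf
  have hpoly : ∀ x y : Polynomial ℚ,
      {L : ℚ | evalAt f (specialCoords i (x.eval L) (y.eval L)) = 0}.Infinite →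
      ∀ c : ℂ, evalAt f (specialCoords i (Polynomial.aeval c x) (Polynomial.aeval c y)) = 0 := by
    intro x y hxy c
    have h0 : evalAt f (specialCoords i x y) = 0 := by
      by_contra hne
      refine hxy ((Polynomial.finite_setOfPred_isRoot hne).subset fun L hL => ?_)
      have := map_evalAt (Polynomial.aeval L) f (specialCoords i x y)
      rw [map_specialCoords] at this
      exact this.trans hL
    have := map_evalAt (Polynomial.aeval c) f (specialCoords i x y)
    rw [h0, map_zero, map_specialCoords] at this
    exact this.symm
  have cast : ∀ a b : ℚ, evalAt f (specialCoords i (a : ℂ) (b : ℂ)) = 0 →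
      evalAt f (specialCoords i a b) = 0 := fun a b h => by
    have := map_evalAt (Algebra.ofId ℚ ℂ) f (specialCoords i a b)
    rw [map_specialCoords] at this
    exact (map_eq_zero (Algebra.ofId ℚ ℂ)).1 (this.trans h)
  have h1 : ∀ c : ℂ, evalAt f (specialCoords i 1 c) = 0 := by
    have := hpoly 1 Polynomial.X (by
      refine (hinf.image (f := fun n : ℕ => ((n : ℚ) + 2) / (n + 1)) ?_).mono ?_
      · intro m _ n _ hmn
        have hm : (m : ℚ) + 1 ≠ 0 := by positivity
        have hn : (n : ℚ) + 1 ≠ 0 := by positivity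
        simp only [div_eq_div_iff hm hn] at hmn
        have : (m : ℚ) = n := by linarith
        exact_mod_cast this
      · rintro _ ⟨n, hn, rfl⟩
        simp only [Set.mem_ofPred_eq, Polynomial.eval_one, Polynomial.eval_X]
        apply cast
        have hn1 : (n : ℂ) + 1 ≠ 0 := by exact_mod_cast n.succ_ne_zero
        refine (evalAt_specialCoords_eq_zero_iff (hS f hf) i (Or.inl hn1) (Or.inl (by simp)) ?_).1
          ((mem_zeroLocus_iff hS (hp n)).1 hn f hf)
        push_cast
        field_simp)
    simpa using this
  -- The point with `u = 0` lies outside the chart `[1:c]`; the vanishing in that chart supplies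
  -- infinitely many zeros in the opposite one.
  by_cases hu : u = 0
  · have := hpoly Polynomial.X 1 (by
      refine (Set.Ioi_infinite (0 : ℚ)).mono fun L hL => ?_
      simp only [Set.mem_ofPred_eq, Polynomial.eval_one, Polynomial.eval_X]
      apply cast
      have hL0 : (L : ℂ) ≠ 0 := by exact_mod_cast (ne_of_gt hL)
      exact (evalAt_specialCoords_eq_zero_iff (hS f hf) i (Or.inl one_ne_zero) (Or.inl hL0)
        (by push_cast; field_simp)).1 (h1 (L : ℂ)⁻¹)) 0
    simp only [Polynomial.aeval_X, map_one] at this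
    exact (evalAt_specialCoords_eq_zero_iff (hS f hf) i (Or.inr one_ne_zero) huv
      (by simp [hu])).1 this
  · exact (evalAt_specialCoords_eq_zero_iff (hS f hf) i (Or.inl one_ne_zero) (Or.inl hu)
      (by field_simp)).1 (h1 (v / u))

/-- A dense open set contains the nonzeros of a form that does not vanish on the open orbit. -/
lemma IsDenseOpen.exists_form {U : Set Y4} (hU : IsDenseOpen U) :
    ∃ f : MvPolynomial (Fin 4 × Fin 2) ℚ, IsMultihomogeneous f ∧
      (∃ w z : ℚ, w ≠ 0 ∧ z ≠ 0 ∧ w ≠ 1 ∧ z ≠ 1 ∧ w ≠ z ∧ evalAt f (orbitCoords w z) ≠ 0) ∧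
      ∀ P : ℚˣ × ℚˣ, evalAt f (orbitCoords (P.1 : ℚ) (P.2 : ℚ)) ≠ 0 → orbitPoint P ∈ U := by
  obtain ⟨⟨S, hS, hUS⟩, -, hdense⟩ := hU
  -- If all defining forms vanished on the open orbit, `U` would lie in the boundary `x y s t = 0`,
  -- a proper closed set, against density.
  have key : ∃ f ∈ S, evalAt f (orbitCoords (MvPolynomial.X 0 : MvPolynomial (Fin 2) ℚ)
      (MvPolynomial.X 1)) ≠ 0 := by
    by_contra! hall
    have hzero : ∀ f ∈ S, ∀ w z : ℂ, evalAt f (orbitCoords w z) = 0 := by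
      intro f hf w z
      have := map_evalAt (MvPolynomial.aeval ![w, z]) f (orbitCoords
        (MvPolynomial.X 0 : MvPolynomial (Fin 2) ℚ) (MvPolynomial.X 1))
      rw [hall f hf, map_zero] at this
      rw [this]
      congr 1
      funext i j
      fin_cases i <;> fin_cases j <;> simp [orbitCoords]
    have hsub := hdense (zeroLocus {∏ k : Fin 2 × Fin 2, MvPolynomial.X
      ((![0, 1] : Fin 2 → Fin 4) k.1, k.2)}) ⟨_, ?_, rfl⟩ ?_
    · have h1 := hsub (Set.mem_univ (orbitPoint ((1, 1) : ℚˣ × ℚˣ))) _ rfl _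
        (isCoords_orbitPoint _)
      simp [Fintype.prod_prod_type, orbitCoords] at h1
    · rintro _ rfl
      exact ⟨_, MvPolynomial.IsWeightedHomogeneous.prod _ _ _ fun k _ => isMultihomogeneous_X _⟩
    · rintro P hP _ rfl v hv
      by_contra hne
      simp only [Fintype.prod_prod_type, Fin.prod_univ_two, map_mul, MvPolynomial.aeval_X,
        Matrix.cons_val_zero, Matrix.cons_val_one, mul_ne_zero_iff, ne_eq] at hne
      obtain ⟨⟨hx, hy⟩, hs, ht⟩ := hne
      obtain ⟨e1, e2⟩ := P.2 v hv
      have hmem : P ∈ Uᶜ := by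
        rw [hUS]
        have hc : IsCoords P.1 (orbitCoords (v 0 1 / v 0 0) (v 1 1 / v 1 0)) := by
          refine isCoords_of_cross hv (fun i h => ?_) fun i => ?_
          · have := congrFun h 0
            fin_cases i <;> simp [orbitCoords, hs, ht] at this
          · fin_cases i <;> simp [orbitCoords] <;> field_simp
            · linear_combination -e1
            · linear_combination -e2
        exact (mem_zeroLocus_iff hS hc).2 fun f hf => hzero f hf _ _
      exact hmem hP
  obtain ⟨f, hf, hne⟩ := key
  refine ⟨f, hS f hf, ?_, fun P hP => ?_⟩
  · set X0 : MvPolynomial (Fin 2) ℚ := MvPolynomial.X 0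
    set X1 : MvPolynomial (Fin 2) ℚ := MvPolynomial.X 1
    have hX : ∀ (i : Fin 2) (c : ℚ), (MvPolynomial.X i - MvPolynomial.C c :
        MvPolynomial (Fin 2) ℚ) ≠ 0 := fun i c h => by
      have := congrArg (MvPolynomial.eval fun _ => c + 1) h
      simp at this
    have hX01 : X0 - X1 ≠ 0 := fun h => by
      have := congrArg (MvPolynomial.eval ![1, 0]) h
      simp [X0, X1] at this
    -- The extra factors make the chosen nonzero of `f` generic: the line joining it to `Q` then has
    -- a slope different from 0 and 1.
    have hprod : evalAt f (orbitCoords X0 X1) * ((X0 - MvPolynomial.C 0) *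
        (X1 - MvPolynomial.C 0) * ((X0 - MvPolynomial.C 1) * (X1 - MvPolynomial.C 1)) * (X0 - X1)) ≠ 0 :=
      mul_ne_zero hne (mul_ne_zero (mul_ne_zero (mul_ne_zero (hX 0 0) (hX 1 0)) (mul_ne_zero (hX 0 1) (hX 1 1)))
        hX01)
    obtain ⟨x, hx⟩ : ∃ x : Fin 2 → ℚ, MvPolynomial.aeval x (evalAt f (orbitCoords X0 X1) *
        ((X0 - MvPolynomial.C 0) * (X1 - MvPolynomial.C 0) *
          ((X0 - MvPolynomial.C 1) * (X1 - MvPolynomial.C 1)) * (X0 - X1))) ≠ 0 := by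
      by_contra! h
      refine hprod (MvPolynomial.funext fun x => ?_)
      rw [← MvPolynomial.coe_aeval_eq_eval]
      exact (h x).trans (map_zero _).symm
    simp only [map_mul, map_sub, mul_ne_zero_iff, map_evalAt, X0, X1, MvPolynomial.aeval_X,
      sub_ne_zero, map_zero, map_one] at hx
    refine ⟨x 0, x 1, by simpa using hx.2.1.1.1, by simpa using hx.2.1.1.2,
      by simpa using hx.2.1.2.1, by simpa using hx.2.1.2.2, hx.2.2, ?_⟩
    convert hx.1 using 2
    funext i j
    fin_cases i <;> fin_cases j <;> simp [orbitCoords]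
  · by_contra hPU
    have hmem : orbitPoint P ∈ Uᶜ := hPU
    rw [hUS, mem_zeroLocus_iff hS (isCoords_orbitPoint P)] at hmem
    have := hmem f hf
    simp only [eq_ratCast, orbitCoords_ratCast, evalAt_ratCast] at this
    exact hP (by exact_mod_cast this)

/-! ### Integral points on Pell conics in general position -/

/-- The rational number `(n + 2) / (n + 1)`. -/
def consecRatio (n : ℕ) : ℚˣ :=
  Units.mk0 (((n + 2 : ℕ) : ℚ) / ((n + 1 : ℕ) : ℚ)) (by positivity)

/-- In the variables `2x + 1`, `2s + 1` the equation is `X² - N S² = 1 - N`, with trivial solution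
`(1, 1)`. The hypothesis makes `(2e + 1) + 2r√N` a unit of norm 1, and multiplying by it produces
ever larger solutions. -/
lemma exists_consecutive_products {N e r : ℕ} (h : e * (e + 1) = N * r ^ 2) (hr : 1 ≤ r) (M : ℕ) :
    ∃ s x : ℕ, M ≤ s ∧ x * (x + 1) = N * (s * (s + 1)) := by
  induction M with
  | zero => exact ⟨0, 0, le_rfl, rfl⟩
  | succ M ih =>
    obtain ⟨s, x, hs, hx⟩ := ih
    refine ⟨(2 * e + 1) * s + e + 2 * r * x + r, (2 * e + 1) * x + e + 2 * r * N * s + r * N,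
      by nlinarith, ?_⟩
    zify at h hx ⊢
    linear_combination (1 + 4 * (e : ℤ) * (e + 1) - 4 * N * r ^ 2) * hx +
      (1 - (N : ℤ)) * h

lemma evalAt_eq_zero_iff_orbitCoords {f : MvPolynomial (Fin 4 × Fin 2) ℚ}
    (hf : IsMultihomogeneous f) {w z : ℚ} (hw : w ≠ 0) (hz : z ≠ 0) {v : Fin 4 → Fin 2 → ℚ}
    (hv : ∀ i, v i 0 ≠ 0) (hc : ∀ i, orbitCoords w z i 0 * v i 1 = orbitCoords w z i 1 * v i 0) :
    evalAt f v = 0 ↔ evalAt f (orbitCoords w z) = 0 := by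
  have h1 := isCoords_orbitPoint (Units.mk0 w hw, Units.mk0 z hz)
  simp only [Units.val_mk0, eq_ratCast, orbitCoords_ratCast] at h1
  have h2 : IsCoords (orbitPoint (Units.mk0 w hw, Units.mk0 z hz)).1
      (fun i j => ((v i j : ℚ) : ℂ)) :=
    isCoords_of_cross h1 (fun i h => hv i (by simpa using congrFun h 0))
      (fun i => by exact_mod_cast hc i)
  have := evalAt_eq_zero_iff_of_isCoords hf h2 h1
  rw [evalAt_ratCast, evalAt_ratCast] at this
  exact_mod_cast this

/-- Homogeneous coordinates of the point with parameter `L` of the nodal curve `C_{1,N}`. -/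
def nodalCoords {R : Type*} [CommRing R] (N L : R) : Fin 4 → Fin 2 → R :=
  ![![L * (N - L), N * (L - 1)], ![N - L, L * (L - 1)], ![(N - L) ^ 2, N * (L - 1) ^ 2],
    ![L ^ 2, N]]

lemma evalAt_nodalCoords_eq_zero_iff {f : MvPolynomial (Fin 4 × Fin 2) ℚ}
    (hf : IsMultihomogeneous f) {N L w z : ℚ} (hL : L ≠ 0) (hL1 : L ≠ 1) (hN : N ≠ 0)
    (hNL : N - L ≠ 0) (hw : w = N * (L - 1) / (L * (N - L))) (hz : z = L * (L - 1) / (N - L)) :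
    evalAt f (nodalCoords N L) = 0 ↔ evalAt f (orbitCoords w z) = 0 := by
  have hL1' : L - 1 ≠ 0 := sub_ne_zero.2 hL1
  refine evalAt_eq_zero_iff_orbitCoords hf (by rw [hw]; positivity) (by rw [hz]; positivity)
    (fun i => ?_) (fun i => ?_)
  · fin_cases i <;> simp [nodalCoords, hL, hNL]
  · fin_cases i <;> simp [nodalCoords, orbitCoords, hw, hz] <;> field_simp

/-- The curves `C_{1,N}` meet the line through `Q` and a nonzero of `f` in distinct points for
distinct `N`. A form vanishing on all of them would have infinitely many zeros on that line. The
choice `N = (k + 1)² - 1` keeps an explicit Pell unit available. -/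
lemma exists_nodalCoords_ne_zero {f : MvPolynomial (Fin 4 × Fin 2) ℚ}
    (hf : IsMultihomogeneous f) {w z : ℚ} (hw1 : w ≠ 1) (hz1 : z ≠ 1)
    (hwz : w ≠ z)     (h : evalAt f (orbitCoords w z) ≠ 0) :
    ∃ k : ℕ, 1 ≤ k ∧ ∃ L : ℚ, evalAt f (nodalCoords ((k ^ 2 + 2 * k : ℕ) : ℚ) L) ≠ 0 := by
  have hw1' : w - 1 ≠ 0 := sub_ne_zero.2 hw1
  have hz1' : z - 1 ≠ 0 := sub_ne_zero.2 hz1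
  set l : ℚ := (z - 1) / (w - 1) with hl
  have hl0 : l ≠ 0 := by positivity
  have hl1 : l ≠ 1 := by
    rw [hl, Ne, div_eq_one_iff_eq hw1']
    intro h
    exact hwz (by linarith)
  have hfin := finite_zeros_evalAt (f := f)
    (orbitCoords (1 + Polynomial.X) (1 + Polynomial.C l * Polynomial.X)) (w - 1) (by
      convert h using 2
      have hlw : l * (w - 1) = z - 1 := by rw [hl]; field_simp
      funext i j
      fin_cases i <;> fin_cases j <;> simp [orbitCoords, hlw])
  by_contra! hall
  set N : ℕ → ℚ := fun k => ((k ^ 2 + 2 * k : ℕ) : ℚ) with hN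
  have hNl : ∀ k ∈ Set.Ioi ⌈l⌉₊, 0 < k ∧ 0 < N k - l := by
    intro k hk
    have h1 : l < k := (Nat.le_ceil l).trans_lt (by exact_mod_cast hk)
    have h2 : (k : ℚ) ≤ N k := Nat.cast_le.2 (by nlinarith : k ≤ k ^ 2 + 2 * k)
    exact ⟨lt_of_le_of_lt (Nat.zero_le _) hk, by linarith⟩
  -- The function is the displacement `w - 1` of the point where the line of slope `l` meets
  -- `C_{1,N}` away from `Q`.
  refine Set.infinite_of_injOn_mapsTo (f := fun k => (l ^ 2 - N k) / (l * (N k - l))) ?_ ?_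
    (Set.Ioi_infinite ⌈l⌉₊) hfin
  · intro k hk k' hk' e
    have h1 := (hNl k hk).2.ne'
    have h2 := (hNl k' hk').2.ne'
    have hl1' : l - 1 ≠ 0 := sub_ne_zero.2 hl1
    have e' : N k = N k' := by
      simp only [] at e
      field_simp at e
      have : l * (l - 1) * (N k - N k') = 0 := by linear_combination -e
      have := (mul_eq_zero.1 this).resolve_left (by positivity)
      linarith
    have e'' : k ^ 2 + 2 * k = k' ^ 2 + 2 * k' := Nat.cast_injective e'
    nlinarith
  · intro k hk
    obtain ⟨hk0, hkl⟩ := hNl k hk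
    have hNk : N k ≠ 0 := by
      simp only [hN]
      positivity
    have := (evalAt_nodalCoords_eq_zero_iff hf hl0 hl1 hNk hkl.ne' rfl rfl).1 (hall k hk0 l)
    simp only [Set.mem_ofPred_eq]
    convert this using 2
    have hkl' := hkl.ne'
    have e1 : 1 + (l ^ 2 - N k) / (l * (N k - l)) = N k * (l - 1) / (l * (N k - l)) := by
      field_simp
      ring
    have e2 : 1 + l * ((l ^ 2 - N k) / (l * (N k - l))) = l * (l - 1) / (N k - l) := by
      field_simp
      ring
    funext i j
    fin_cases i <;> fin_cases j <;> simp [orbitCoords, e1, e2]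

/-- These points lie on `C_{1,N}` with slope `L = (x + 1)/(s + 1)`. The form `f` has finitely many
zeros there, and `s` is a function of `L`, so all points with large `s` avoid them. -/
lemma IsDenseOpen.exists_consecRatio {U : Set Y4} (hU : IsDenseOpen U) :
    ∃ N : ℕ, ∀ M : ℕ, ∃ s x : ℕ, M ≤ s ∧ s ≤ x ∧
      (x + 1) * (x + 2) = N * ((s + 1) * (s + 2)) ∧
      orbitPoint (consecRatio x, consecRatio s) ∈ U := by
  obtain ⟨f, hf, ⟨w, z, -, -, hw1, hz1, hwz, hne⟩, hmem⟩ := hU.exists_form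
  obtain ⟨k, hk, L₀, hL₀⟩ := exists_nodalCoords_ne_zero hf hw1 hz1 hwz hne
  set N : ℕ := k ^ 2 + 2 * k with hNk
  have hN3 : 3 ≤ N := by nlinarith
  have hN3' : (3 : ℚ) ≤ N := by exact_mod_cast hN3
  have cast : ∀ L : ℚ, nodalCoords (N : ℚ) L = fun i j =>
      (nodalCoords (Polynomial.C (N : ℚ)) Polynomial.X i j).eval L := by
    intro L
    funext i j
    fin_cases i <;> fin_cases j <;> simp [nodalCoords]
  have hfin := finite_zeros_evalAt (f := f) (nodalCoords (Polynomial.C (N : ℚ)) Polynomial.X) L₀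
    (by rwa [← cast])
  simp only [← cast] at hfin
  -- On the Pell points, `(L - N)/(N - L²)` equals `s + 1`; hence `b` bounds `s + 1` at every bad
  -- point.
  obtain ⟨b, hb⟩ := (hfin.image fun L : ℚ => (L - N) / (N - L ^ 2)).bddAbove
  refine ⟨N, fun M => ?_⟩
  -- Here `N + 1 = (k + 1)²`, so `e = N` and `r = k + 1` satisfy `e(e + 1) = N r²`.
  obtain ⟨s, x, hs, hx⟩ := exists_consecutive_products (N := N) (e := N) (r := k + 1)
    (by rw [hNk]; ring) (by omega) (M + ⌈b⌉₊ + 1 + 1)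
  obtain ⟨s, rfl⟩ : ∃ s', s = s' + 1 := ⟨s - 1, by omega⟩
  have hsx : s + 1 < x := by
    by_contra! hle
    nlinarith [Nat.mul_le_mul hle (Nat.add_le_add_right hle 1),
      Nat.mul_le_mul_right ((s + 1) * (s + 1 + 1)) hN3]
  obtain ⟨x, rfl⟩ : ∃ x', x = x' + 1 := ⟨x - 1, by omega⟩
  refine ⟨s, x, by omega, by omega, hx, hmem _ fun h0 => ?_⟩
  have hxq : ((x : ℚ) + 1) * (x + 1 + 1) = N * ((s + 1) * (s + 1 + 1)) := by exact_mod_cast hx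
  have hsx' : (s : ℚ) < x := by exact_mod_cast (by omega : s < x)
  set L : ℚ := (x + 1) / (s + 1) with hL
  have hs0 : (0 : ℚ) < s + 1 := by positivity
  have hx0 : (0 : ℚ) < x + 1 := by positivity
  have hL0 : 0 < L := by positivity
  have hxL : (x : ℚ) + 1 = L * (s + 1) := by rw [hL]; field_simp
  have hL1 : 1 < L := by rw [hL, lt_div_iff₀ hs0]; linarith
  have hNeq : (N : ℚ) * (s + 2) = L * (x + 2) := by
    apply mul_left_cancel₀ hs0.ne'
    linear_combination -hxq + (x + 2) * hxL
  have hNL : (N : ℚ) - L ≠ 0 := by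
    intro h
    have : L * ((x : ℚ) - s) = 0 := by linear_combination (s + 2) * h - hNeq
    rcases mul_eq_zero.1 this with h | h <;> linarith
  have hlin : (s + 1 : ℚ) * (N - L ^ 2) = L - N := by
    linear_combination hNeq + L * hxL
  have hNL2 : (N : ℚ) - L ^ 2 ≠ 0 := by
    intro h
    rw [h, mul_zero] at hlin
    exact hNL (by linarith)
  have key : (s + 2 : ℚ) * (N - L) = L * (L - 1) * (s + 1) := by
    linear_combination hNeq + L * hxL
  have hL_mem : evalAt f (nodalCoords (N : ℚ) L) = 0 := by
    refine (evalAt_nodalCoords_eq_zero_iff hf hL0.ne' hL1.ne' (by linarith) hNL ?_ ?_).2 h0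
    · simp only [consecRatio, Units.val_mk0]
      push_cast
      rw [div_eq_div_iff (by positivity) (by positivity)]
      linear_combination N * key - (N - L) * hNeq - N * (L - 1) * hxL
    · simp only [consecRatio, Units.val_mk0]
      push_cast
      rw [div_eq_div_iff (by positivity) (by positivity)]
      linear_combination key
  have := hb ⟨L, hL_mem, rfl⟩
  simp only [] at this
  rw [← hlin, mul_div_assoc, div_self hNL2, mul_one] at this
  have h1 : b ≤ (⌈b⌉₊ : ℚ) := Nat.le_ceil b
  have h2 : (⌈b⌉₊ : ℚ) ≤ s := by exact_mod_cast (by omega : ⌈b⌉₊ ≤ s)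
  linarith

/-! ### Heights -/

lemma prod_gcd_eq_gcd_mul {x y s t : ℕ} (hxy : x.Coprime y) (hst : s.Coprime t) :
    x.gcd s * x.gcd t * y.gcd s * y.gcd t = (x * y).gcd (s * t) := by
  rw [hst.gcd_mul, Nat.gcd_comm (x * y) s, Nat.gcd_comm (x * y) t, hxy.gcd_mul, hxy.gcd_mul,
    Nat.gcd_comm s x, Nat.gcd_comm s y, Nat.gcd_comm t x, Nat.gcd_comm t y]
  ring

/-- Dividing by `G` clears the denominator: the height becomes a maximum of integers, a square times
`p` or `q`. -/
lemma anticanonicalHeight_eq {w z : ℚ} {G p q : ℕ} (hG0 : 0 < G)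
    (hG : (w.den * w.num.natAbs).gcd (z.den * z.num.natAbs) = G)
    (hp : w.den * w.num.natAbs = p * G) (hq : z.den * z.num.natAbs = q * G) :
    anticanonicalHeight w z = ((max (max (w.den ^ 2 * q) (w.num.natAbs ^ 2 * q))
      (max (z.num.natAbs ^ 2 * p) (z.den ^ 2 * p)) : ℕ) : ℝ) := by
  unfold anticanonicalHeight
  simp only []
  rw [prod_gcd_eq_gcd_mul w.reduced.symm z.reduced.symm, hG, div_eq_iff (by positivity)]
  have : ∀ c : ℕ, c * w.den * w.num.natAbs = c * p * G := fun c => by rw [mul_assoc, hp, mul_assoc]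
  have : ∀ c : ℕ, c * z.den * z.num.natAbs = c * q * G := fun c => by rw [mul_assoc, hq, mul_assoc]
  simp only [*]
  norm_cast
  simp only [max_mul_of_nonneg _ _ (Nat.zero_le G)]

lemma anticanonicalHeight_nonneg (w z : ℚ) : 0 ≤ anticanonicalHeight w z := by
  unfold anticanonicalHeight
  positivity

lemma exists_anticanonicalHeight_eq (P : ℚˣ × ℚˣ) : ∃ G p q : ℕ, 0 < G ∧ 0 < p ∧ 0 < q ∧
    (P.1 : ℚ).den * (P.1 : ℚ).num.natAbs = p * G ∧
    (P.2 : ℚ).den * (P.2 : ℚ).num.natAbs = q * G ∧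
    anticanonicalHeight P.1 P.2 =
      ((max (max ((P.1 : ℚ).den ^ 2 * q) ((P.1 : ℚ).num.natAbs ^ 2 * q))
      (max ((P.2 : ℚ).num.natAbs ^ 2 * p) ((P.2 : ℚ).den ^ 2 * p)) : ℕ) : ℝ) := by
  have h1 : 0 < (P.1 : ℚ).den * (P.1 : ℚ).num.natAbs :=
    Nat.mul_pos (P.1 : ℚ).den_pos (Int.natAbs_pos.2 (Rat.num_ne_zero.2 P.1.ne_zero))
  have h2 : 0 < (P.2 : ℚ).den * (P.2 : ℚ).num.natAbs :=
    Nat.mul_pos (P.2 : ℚ).den_pos (Int.natAbs_pos.2 (Rat.num_ne_zero.2 P.2.ne_zero))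
  set G := ((P.1 : ℚ).den * (P.1 : ℚ).num.natAbs).gcd ((P.2 : ℚ).den * (P.2 : ℚ).num.natAbs) with hG
  have hG0 : 0 < G := Nat.gcd_pos_of_pos_left _ h1
  obtain ⟨p, hp⟩ := Nat.gcd_dvd_left ((P.1 : ℚ).den * (P.1 : ℚ).num.natAbs)
    ((P.2 : ℚ).den * (P.2 : ℚ).num.natAbs)
  obtain ⟨q, hq⟩ := Nat.gcd_dvd_right ((P.1 : ℚ).den * (P.1 : ℚ).num.natAbs)
    ((P.2 : ℚ).den * (P.2 : ℚ).num.natAbs)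
  rw [← hG, mul_comm G] at hp hq
  refine ⟨G, p, q, hG0, ?_, ?_, hp, hq, anticanonicalHeight_eq hG0 rfl hp hq⟩
  · exact Nat.pos_of_ne_zero fun h => by rw [hp, h, zero_mul] at h1; exact h1.false
  · exact Nat.pos_of_ne_zero fun h => by rw [hq, h, zero_mul] at h2; exact h2.false

/-- The height of a point and its reduced coordinates: `x`, `s` are the denominators, `y = x + a`,
`t = s + c` the numerators, `p` and `q` the quotients of `|xy|` and `|st|` by the product of the
four greatest common divisors. -/
lemma exists_height_data (P : ℚˣ × ℚˣ) : ∃ (G p q x s : ℕ) (a c : ℤ), 0 < G ∧ 0 < p ∧ 0 < q ∧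
    0 < x ∧ 0 < s ∧ x = (P.1 : ℚ).den ∧ s = (P.2 : ℚ).den ∧
    (P.1 : ℚ).num = x + a ∧ (P.2 : ℚ).num = s + c ∧
    (x : ℤ) * |x + a| = p * G ∧ (s : ℤ) * |s + c| = q * G ∧
    (x : ℝ) ^ 2 * q ≤ anticanonicalHeight P.1 P.2 ∧
    ((x : ℝ) + a) ^ 2 * q ≤ anticanonicalHeight P.1 P.2 ∧
    ((s : ℝ) + c) ^ 2 * p ≤ anticanonicalHeight P.1 P.2 ∧
    (s : ℝ) ^ 2 * p ≤ anticanonicalHeight P.1 P.2 ∧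
    chart P = ((a : ℝ) / x, (c : ℝ) / s) := by
  obtain ⟨G, p, q, hG, hp, hq, h1, h2, h3⟩ := exists_anticanonicalHeight_eq P
  have hx := (P.1 : ℚ).den_pos
  have hs := (P.2 : ℚ).den_pos
  have e1 : (((P.1 : ℚ).num.natAbs : ℕ) : ℝ) ^ 2 = ((P.1 : ℚ).num : ℝ) ^ 2 := by
    rw [Nat.cast_natAbs, Int.cast_abs, sq_abs]
  have e2 : (((P.2 : ℚ).num.natAbs : ℕ) : ℝ) ^ 2 = ((P.2 : ℚ).num : ℝ) ^ 2 := by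
    rw [Nat.cast_natAbs, Int.cast_abs, sq_abs]
  have c1 : (((P.1 : ℚ) : ℚ) : ℝ) = ((P.1 : ℚ).num : ℝ) / (P.1 : ℚ).den := Rat.cast_def _
  have c2 : (((P.2 : ℚ) : ℚ) : ℝ) = ((P.2 : ℚ).num : ℝ) / (P.2 : ℚ).den := Rat.cast_def _
  have hx' : ((P.1 : ℚ).den : ℝ) ≠ 0 := by positivity
  have hs' : ((P.2 : ℚ).den : ℝ) ≠ 0 := by positivity
  refine ⟨G, p, q, (P.1 : ℚ).den, (P.2 : ℚ).den, (P.1 : ℚ).num - (P.1 : ℚ).den,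
    (P.2 : ℚ).num - (P.2 : ℚ).den, hG, hp, hq, hx, hs, rfl, rfl, by ring, by ring, ?_, ?_,
    ?_, ?_, ?_, ?_, ?_⟩
  · rw [add_sub_cancel, ← Int.natCast_natAbs]
    exact_mod_cast h1
  · rw [add_sub_cancel, ← Int.natCast_natAbs]
    exact_mod_cast h2
  · rw [h3]
    exact_mod_cast (le_max_left _ _).trans (le_max_left _ _)
  · push_cast
    rw [h3, add_sub_cancel, ← e1]
    exact_mod_cast (le_max_right _ _).trans (le_max_left _ _)
  · push_cast
    rw [h3, add_sub_cancel, ← e2]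
    exact_mod_cast (le_max_left _ _).trans (le_max_right _ _)
  · rw [h3]
    exact_mod_cast (le_max_right _ _).trans (le_max_right _ _)
  · simp only [chart, c1, c2]
    push_cast
    rw [sub_div, sub_div, div_self hx', div_self hs']

/-- A nonzero displacement `b/n` has `|b| ≥ 1`, while the height is at least `n²`. At least one of
the two displacements is nonzero when `P ≠ 1`. -/
lemma one_le_norm_chart_sq_mul_height {P : ℚˣ × ℚˣ} (hP : P ≠ 1) :
    1 ≤ ‖chart P‖ ^ 2 * anticanonicalHeight P.1 P.2 := by
  obtain ⟨G, p, q, x, s, a, c, hG, hp, hq, hx, hs, ex, es, ew, ez, -, -, h1, -, -, h4, hc⟩ :=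
    exists_height_data P
  have key : ∀ (n m : ℕ) (b : ℤ), 0 < n → 0 < m → b ≠ 0 →
      (n : ℝ) ^ 2 * m ≤ anticanonicalHeight P.1 P.2 → |(b : ℝ) / n| ≤ ‖chart P‖ →
      1 ≤ ‖chart P‖ ^ 2 * anticanonicalHeight P.1 P.2 := by
    intro n m b hn hm hb h h'
    have hb1 : (1 : ℝ) ≤ |(b : ℝ)| := by exact_mod_cast Int.one_le_abs hb
    have hm1 : (1 : ℝ) ≤ m := by exact_mod_cast hm
    have hn' : (0 : ℝ) < n := by exact_mod_cast hn
    rw [abs_div, Nat.abs_cast, div_le_iff₀ hn'] at h'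
    calc (1 : ℝ) ≤ (‖chart P‖ * n) ^ 2 * m :=
          one_le_mul_of_one_le_of_one_le (one_le_pow₀ (hb1.trans h')) hm1
      _ = ‖chart P‖ ^ 2 * ((n : ℝ) ^ 2 * m) := by ring
      _ ≤ _ := by gcongr
  by_cases ha : a = 0
  · by_cases hc0 : c = 0
    · refine absurd ?_ hP
      have one : ∀ (u : ℚˣ) (n : ℕ), n = (u : ℚ).den → (u : ℚ).num = n + 0 → u = 1 := by
        intro u n h1 h2
        apply Units.ext
        rw [← Rat.num_div_den (u : ℚ), ← h1, h2]
        have : (n : ℚ) ≠ 0 := by rw [h1]; exact_mod_cast (u : ℚ).den_nz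
        simp [this]
      exact Prod.ext (one _ x ex (by rw [ew, ha])) (one _ s es (by rw [ez, hc0]))
    · exact key s p c hs hp hc0 h4 (by rw [hc]; exact le_max_right _ _)
  · exact key x q a hx hq ha h1 (by rw [hc]; exact le_max_left _ _)

/-! ### Approximation constants -/

lemma two_le_approxConst (V : Set Y4) : 2 ≤ approxConst V := by
  refine le_sInf ?_
  rintro _ ⟨γ, ⟨hγ, y, C, hC, hy, hlim, hb⟩, rfl⟩
  have : (2 : ℝ) ≤ γ := by
    by_contra! hlt
    have h0 : Tendsto (fun i => ‖chart (y i)‖ ^ (2 - γ) * C) atTop (𝓝 (0 ^ (2 - γ) * C)) :=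
      (hlim.rpow_const (Or.inr (by linarith))).mul_const C
    rw [Real.zero_rpow (by linarith), zero_mul] at h0
    obtain ⟨i, hi⟩ := (h0.eventually (gt_mem_nhds one_pos)).exists
    have h1 := one_le_norm_chart_sq_mul_height (hy i).1
    have hpos : 0 < ‖chart (y i)‖ := by
      by_contra! h
      rw [le_antisymm h (norm_nonneg _)] at h1
      norm_num at h1
    have h2 : ‖chart (y i)‖ ^ (2 : ℕ) = ‖chart (y i)‖ ^ (2 - γ) * ‖chart (y i)‖ ^ γ := by
      rw [← Real.rpow_add hpos, ← Real.rpow_natCast]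
      norm_num
    rw [h2, mul_assoc] at h1
    have := mul_le_mul_of_nonneg_left (hb i).le
      (Real.rpow_nonneg (norm_nonneg (chart (y i))) (2 - γ))
    linarith
  calc (2 : ℝ≥0∞) = ENNReal.ofReal 2 := by simp
    _ ≤ _ := ENNReal.ofReal_le_ofReal this

lemma approxConst_le_two {V : Set Y4} {C : ℝ} (h : ∀ M : ℕ, ∃ P : ℚˣ × ℚˣ, P ≠ 1 ∧
    orbitPoint P ∈ V ∧ ‖chart P‖ ≤ 1 / ((M : ℝ) + 1) ∧
    ‖chart P‖ ^ 2 * anticanonicalHeight P.1 P.2 ≤ C) : approxConst V = 2 := by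
  refine le_antisymm (sInf_le ⟨2, ⟨two_pos, ?_⟩, by simp⟩) (two_le_approxConst V)
  choose y hy1 hyV hyd hyC using h
  refine ⟨y, |C| + 1, by positivity, fun i => ⟨hy1 i, hyV i⟩,
    squeeze_zero (fun _ => norm_nonneg _) hyd tendsto_one_div_add_atTop_nhds_zero_nat, fun i => ?_⟩
  rw [Real.rpow_two]
  linarith [hyC i, le_abs_self C]

lemma consecRatio_num_den (n : ℕ) :
    (consecRatio n : ℚ).num = n + 2 ∧ (consecRatio n : ℚ).den = n + 1 := by
  have hc : Nat.Coprime ((n + 2 : ℕ) : ℤ).natAbs ((n + 1 : ℕ) : ℤ).natAbs := by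
    simp only [Int.natAbs_natCast]
    exact (Nat.coprime_self_add_left.2 (Nat.coprime_one_left _) : Nat.Coprime (n + 1 + 1) (n + 1))
  have h0 : (0 : ℤ) < ((n + 1 : ℕ) : ℤ) := by positivity
  constructor
  · have := Rat.num_div_eq_of_coprime h0 hc
    simpa [consecRatio] using this
  · have := Rat.den_div_eq_of_coprime h0 hc
    have h2 : ((((n + 2 : ℕ) : ℤ) : ℚ) / (((n + 1 : ℕ) : ℤ) : ℚ)).den = n + 1 := by
      exact_mod_cast this
    simpa [consecRatio] using h2

lemma consecRatio_sub_one (n : ℕ) : ((consecRatio n : ℚ) : ℝ) - 1 = 1 / (n + 1) := by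
  simp only [consecRatio, Units.val_mk0]
  push_cast
  field_simp
  ring

lemma consecRatio_ne_one (n : ℕ) : consecRatio n ≠ 1 := by
  intro h
  have := consecRatio_sub_one n
  rw [h] at this
  have h2 : (0 : ℝ) < 1 / (n + 1) := by positivity
  simp at this
  linarith

/-- The hypothesis says that `G = (s + 1)(s + 2)`, `p = N`, `q = 1`. The term `(x + 2)²` is
dominated by `N(s + 2)²` because `(x + 2)/(x + 1) ≤ (s + 2)/(s + 1)`. -/
lemma height_consecRatio {N s x : ℕ} (hsx : s ≤ x)
    (h : (x + 1) * (x + 2) = N * ((s + 1) * (s + 2))) :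
    anticanonicalHeight (consecRatio x) (consecRatio s) ≤ N * (s + 2) ^ 2 ∧
      ‖chart (consecRatio x, consecRatio s)‖ = 1 / (s + 1) := by
  obtain ⟨nx, dx⟩ := consecRatio_num_den x
  obtain ⟨ns, ds⟩ := consecRatio_num_den s
  have nx' : (consecRatio x : ℚ).num.natAbs = x + 2 := by omega
  have ns' : (consecRatio s : ℚ).num.natAbs = s + 2 := by omega
  constructor
  · rw [anticanonicalHeight_eq (G := (s + 1) * (s + 2)) (p := N) (q := 1) (by positivity)]
    · rw [nx', ns', dx, ds]
      norm_cast
      rw [mul_one, mul_one, mul_comm _ N, mul_comm _ N]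
      refine max_le (max_le ?_ ?_) (max_le le_rfl ?_)
      · nlinarith
      · refine le_of_mul_le_mul_right ?_ x.succ_pos
        calc (x + 2) ^ 2 * (x + 1) = N * (s + 2) * ((s + 1) * (x + 2)) := by
              linear_combination (x + 2) * h
          _ ≤ N * (s + 2) * ((s + 2) * (x + 1)) := Nat.mul_le_mul_left _ (by nlinarith)
          _ = N * (s + 2) ^ 2 * (x + 1) := by ring
      · gcongr
        omega
    · rw [nx', ns', dx, ds, h]
      exact Nat.gcd_mul_left_left _ _
    · rw [nx', dx, h]
    · rw [ns', ds, one_mul]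
  · rw [Prod.norm_def]
    simp only [chart, consecRatio_sub_one, Real.norm_eq_abs]
    rw [abs_of_pos (by positivity), abs_of_pos (by positivity), max_eq_right]
    gcongr

/-- The point with parameter `[n+1:n+2]` of the `i`-th special curve. -/
def specialPoint (i : Fin 4) (n : ℕ) : ℚˣ × ℚˣ :=
  ![(1, consecRatio n), (consecRatio n, 1), (consecRatio n, (consecRatio n)⁻¹),
    (consecRatio n, consecRatio n)] i

lemma specialPoint_injective (i : Fin 4) : Function.Injective (specialPoint i) := by
  intro m n h
  have : consecRatio m = consecRatio n := by
    fin_cases i <;> simp [specialPoint] at h <;> exact h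
  have h1 := consecRatio_sub_one m
  rw [this, consecRatio_sub_one n] at h1
  simpa using h1.symm

lemma isCoords_specialPoint (i : Fin 4) (n : ℕ) :
    IsCoords (orbitPoint (specialPoint i n)).1
      (specialCoords i ((n : ℂ) + 1) ((n : ℂ) + 2)) := by
  have h1 : (n : ℂ) + 1 ≠ 0 := by exact_mod_cast n.succ_ne_zero
  have h2 : (n : ℂ) + 2 ≠ 0 := by exact_mod_cast (n + 1).succ_ne_zero
  refine isCoords_of_cross (isCoords_orbitPoint _) (specialCoords_ne_zero i (Or.inl h1))
    fun k => ?_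
  fin_cases i <;> fin_cases k <;>
    simp [specialPoint, specialCoords, orbitCoords, consecRatio] <;> field_simp

lemma orbitPoint_specialPoint_mem (i : Fin 4) (n : ℕ) :
    orbitPoint (specialPoint i n) ∈ specialCurve i := by
  rw [orbitPoint_mem_specialCurve_iff]
  fin_cases i <;> simp [specialPoint]

lemma height_specialPoint (i : Fin 4) (n : ℕ) :
    anticanonicalHeight (specialPoint i n).1 (specialPoint i n).2 ≤ (n + 2) ^ 2 := by
  obtain ⟨hn, hd⟩ := consecRatio_num_den n
  have hn' : (consecRatio n : ℚ).num.natAbs = n + 2 := by omega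
  have hnpos : 0 < (consecRatio n : ℚ).num := by omega
  have hin : (((consecRatio n)⁻¹ : ℚˣ) : ℚ).num.natAbs = n + 1 := by
    rw [Units.val_inv_eq_inv_val, Rat.num_inv, Int.sign_eq_one_of_pos hnpos, hd, one_mul]
    rfl
  have hid : (((consecRatio n)⁻¹ : ℚˣ) : ℚ).den = n + 2 := by
    rw [Units.val_inv_eq_inv_val, Rat.den_inv, if_neg hnpos.ne', hn']
  have h1 : (n + 1) * (n + 2) ≤ (n + 2) ^ 2 := by nlinarith
  have h2 : 1 ≤ (n + 2) ^ 2 := Nat.one_le_pow _ _ (by omega)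
  have h3 : (n + 1) ^ 2 ≤ (n + 2) ^ 2 := Nat.pow_le_pow_left (by omega) 2
  have hpos : 0 < (n + 1) * (n + 2) := by positivity
  have key : anticanonicalHeight (specialPoint i n).1 (specialPoint i n).2 ≤
      (((n + 2) ^ 2 : ℕ) : ℝ) := by
    fin_cases i <;>
      simp only [specialPoint, Fin.zero_eta, Fin.mk_one, Fin.reduceFinMk, Matrix.cons_val]
    · rw [anticanonicalHeight_eq (G := 1) (p := 1) (q := (n + 1) * (n + 2)) one_pos] <;>
        simp [hn', hd]
      exact ⟨mod_cast h1, mod_cast h3⟩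
    · rw [anticanonicalHeight_eq (G := 1) (p := (n + 1) * (n + 2)) (q := 1) one_pos] <;>
        simp [hn', hd]
      exact ⟨mod_cast h3, mod_cast h1⟩
    · rw [anticanonicalHeight_eq (G := (n + 1) * (n + 2)) (p := 1) (q := 1) hpos]
      · rw [hn', hd, hin, hid]
        norm_cast
        simp [h3]
      · rw [hn', hd, hin, hid, mul_comm (n + 2), Nat.gcd_self]
      · rw [hn', hd, one_mul]
      · rw [hin, hid]
        ring
    · rw [anticanonicalHeight_eq (G := (n + 1) * (n + 2)) (p := 1) (q := 1) hpos] <;>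
        simp only [hn', hd, Nat.gcd_self, one_mul, mul_one]
      norm_cast
      simp [h3]
  exact_mod_cast key

lemma norm_chart_specialPoint (i : Fin 4) (n : ℕ) :
    ‖chart (specialPoint i n)‖ ≤ 1 / ((n : ℝ) + 1) := by
  have h1 : |((consecRatio n : ℚ) : ℝ) - 1| ≤ 1 / ((n : ℝ) + 1) := by
    rw [consecRatio_sub_one, abs_of_pos (by positivity)]
  have h2 : |(((consecRatio n)⁻¹ : ℚˣ) : ℚ) - (1 : ℝ)| ≤ 1 / ((n : ℝ) + 1) := by
    have : ((((consecRatio n)⁻¹ : ℚˣ) : ℚ) : ℝ) - 1 = - (1 / (n + 2)) := by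
      simp only [consecRatio, Units.val_inv_eq_inv_val, Units.val_mk0]
      push_cast
      field_simp
      ring
    rw [this, abs_neg, abs_of_pos (by positivity)]
    gcongr
    norm_num
  have h0 : |(((1 : ℚˣ) : ℚ) : ℝ) - 1| ≤ 1 / ((n : ℝ) + 1) := by
    rw [Units.val_one, Rat.cast_one, sub_self, abs_zero]
    positivity
  rw [Prod.norm_def]
  fin_cases i
  · exact max_le h0 h1
  · exact max_le h1 h0
  · exact max_le h1 h2
  · exact max_le h1 h1

lemma specialPoint_ne_one (i : Fin 4) (n : ℕ) : specialPoint i n ≠ 1 := by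
  intro h
  apply consecRatio_ne_one n
  fin_cases i <;> simpa [specialPoint, Prod.ext_iff] using h

lemma IsDenseOpen.approxConst_eq {U : Set Y4} (hU : IsDenseOpen U) : approxConst U = 2 := by
  obtain ⟨N, hN⟩ := hU.exists_consecRatio
  refine approxConst_le_two (C := 4 * N) fun M => ?_
  obtain ⟨s, x, hs, hsx, hx, hmem⟩ := hN M
  obtain ⟨h1, h2⟩ := height_consecRatio hsx hx
  have hs' : (M : ℝ) ≤ s := by exact_mod_cast hs
  refine ⟨_, fun h => consecRatio_ne_one s (congrArg Prod.snd h), hmem, ?_, ?_⟩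
  · rw [h2]
    gcongr
  · rw [h2]
    calc (1 / ((s : ℝ) + 1)) ^ 2 * anticanonicalHeight (consecRatio x) (consecRatio s)
        ≤ (1 / ((s : ℝ) + 1)) ^ 2 * (N * (s + 2) ^ 2) := by gcongr
      _ ≤ (1 / ((s : ℝ) + 1)) ^ 2 * (N * (2 * (s + 1)) ^ 2) := by
          gcongr
          linarith
      _ = 4 * N := by
          field_simp
          ring

lemma essentialConst_eq : essentialConst = 2 :=
  le_antisymm (iSup₂_le fun _ hU => hU.approxConst_eq.le)
    (isDenseOpen_univ.approxConst_eq.ge.trans (le_iSup₂ (f := fun U _ => approxConst U) _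
      isDenseOpen_univ))

lemma approxConst_specialCurves : approxConst specialCurves = 2 := by
  refine approxConst_le_two (C := 4) fun n => ⟨specialPoint 0 n, specialPoint_ne_one 0 n,
    Set.mem_iUnion.2 ⟨0, orbitPoint_specialPoint_mem 0 n⟩, norm_chart_specialPoint 0 n, ?_⟩
  calc ‖chart (specialPoint 0 n)‖ ^ 2 * anticanonicalHeight _ _
      ≤ (1 / ((n : ℝ) + 1)) ^ 2 * (n + 2) ^ 2 :=
        mul_le_mul (pow_le_pow_left₀ (norm_nonneg _) (norm_chart_specialPoint 0 n) 2)
          (height_specialPoint 0 n) (anticanonicalHeight_nonneg _ _) (by positivity)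
    _ ≤ (1 / ((n : ℝ) + 1)) ^ 2 * (2 * (n + 1)) ^ 2 := by
        gcongr
        linarith
    _ = 4 := by
        field_simp
        norm_num

/-! ### The points counted by the zoom -/

/-- The rational points of the open orbit in `A`, of height at most `B` and at distance at most
`ε / √B` of `Q`. -/
def zoomPoints (A : Set Y4) (ε B : ℝ) : Set (ℚˣ × ℚˣ) :=
  {P | orbitPoint P ∈ A ∧ anticanonicalHeight P.1 P.2 ≤ B ∧ √B * ‖chart P‖ ≤ ε}

lemma zoomMeasure_apply (A : Set Y4) (B r : ℝ) {S : Set (ℝ × ℝ)} (hS : MeasurableSet S) :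
    zoomMeasure A B r S = ({P : ℚˣ × ℚˣ | orbitPoint P ∈ A ∧ anticanonicalHeight P.1 P.2 ≤ B ∧
      B ^ (1 / r) • chart P ∈ S}.encard : ℝ≥0∞) := by
  rw [zoomMeasure, Measure.sum_apply _ hS]
  have h : {P : ℚˣ × ℚˣ | orbitPoint P ∈ A ∧ anticanonicalHeight P.1 P.2 ≤ B ∧
      B ^ (1 / r) • chart P ∈ S} = Subtype.val '' {P : {P : ℚˣ × ℚˣ // orbitPoint P ∈ A ∧
        anticanonicalHeight P.1 P.2 ≤ B} | B ^ (1 / r) • chart P.1 ∈ S} := by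
    ext P
    exact ⟨fun h => ⟨⟨P, h.1, h.2.1⟩, h.2.2, rfl⟩, by rintro ⟨P, h, rfl⟩; exact ⟨P.2.1, P.2.2, h⟩⟩
  rw [h, Subtype.val_injective.encard_image, ← ENNReal.tsum_set_one,
    tsum_subtype _ fun _ => (1 : ℝ≥0∞)]
  refine tsum_congr fun P => ?_
  rw [Measure.dirac_apply' _ hS]
  by_cases hP : B ^ (1 / r) • chart P.1 ∈ S
  · rw [Set.indicator_of_mem hP, Set.indicator_of_mem (by exact hP)]
    rfl
  · rw [Set.indicator_of_notMem hP, Set.indicator_of_notMem (by exact hP)]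

lemma zoomMeasure_closedBall (A : Set Y4) (ε B : ℝ) :
    zoomMeasure A B 2 (Metric.closedBall 0 ε) = ((zoomPoints A ε B).encard : ℝ≥0∞) := by
  rw [zoomMeasure_apply _ _ _ measurableSet_closedBall]
  simp only [zoomPoints, mem_closedBall_zero_iff, norm_smul, Real.norm_eq_abs,
    ← Real.sqrt_eq_rpow, abs_of_nonneg (Real.sqrt_nonneg B)]

lemma rat_eq_of_num_den {r : ℚ} {x : ℕ} {a : ℤ} (hx : x = r.den) (ha : r.num = x + a) :
    r * x = x + a := by
  have := Rat.mul_den_eq_num r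
  rw [← hx, ha] at this
  exact_mod_cast this

/-- The integers attached to a point near `Q`: it is `((x + a) / x, (s + c) / s)`. -/
lemma zoomPoints_data {A : Set Y4} {ε B : ℝ} (hB : ε < √B) {P : ℚˣ × ℚˣ}
    (hP : P ∈ zoomPoints A ε B) : ∃ (G p q x s : ℕ) (a c : ℤ), 0 < G ∧ 0 < p ∧ 0 < q ∧
      0 < x ∧ 0 < s ∧ |a| < x ∧ |c| < s ∧
      (P.1 : ℚ) * x = x + a ∧ (P.2 : ℚ) * s = s + c ∧
      (x : ℤ) * (x + a) = p * G ∧ (s : ℤ) * (s + c) = q * G ∧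
      (q : ℝ) * a ^ 2 ≤ ε ^ 2 ∧ (p : ℝ) * c ^ 2 ≤ ε ^ 2 ∧
      (x : ℝ) ^ 2 * q ≤ B ∧ ((x : ℝ) + a) ^ 2 * q ≤ B ∧ ((s : ℝ) + c) ^ 2 * p ≤ B ∧
      (s : ℝ) ^ 2 * p ≤ B ∧
      √B * |(a : ℝ)| ≤ ε * x ∧ √B * |(c : ℝ)| ≤ ε * s ∧
      chart P = ((a : ℝ) / x, (c : ℝ) / s) := by
  obtain ⟨-, hH, hd⟩ := hP
  obtain ⟨G, p, q, x, s, a, c, hG, hp, hq, hx, hs, ex, es, ew, ez, h1, h2, b1, b2, b3, b4, hc⟩ :=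
    exists_height_data P
  have hx' : (0 : ℝ) < x := by exact_mod_cast hx
  have hs' : (0 : ℝ) < s := by exact_mod_cast hs
  have hε : 0 ≤ ε := le_trans (by positivity) hd
  have hB0 : 0 < √B := hε.trans_lt hB
  have hB0' : 0 < B := Real.sqrt_pos.1 hB0
  have key : ∀ (n : ℕ) (b : ℤ), 0 < n → |(b : ℝ) / n| ≤ ‖chart P‖ →
      √B * |(b : ℝ)| ≤ ε * n ∧ |b| < n := by
    intro n b hn hb
    have hn' : (0 : ℝ) < n := by exact_mod_cast hn
    rw [abs_div, Nat.abs_cast, div_le_iff₀ hn'] at hb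
    have h1 : √B * |(b : ℝ)| ≤ ε * n := by
      calc √B * |(b : ℝ)| ≤ √B * (‖chart P‖ * n) := by gcongr
        _ = (√B * ‖chart P‖) * n := by ring
        _ ≤ ε * n := by gcongr
    refine ⟨h1, ?_⟩
    have : √B * |(b : ℝ)| < √B * n := h1.trans_lt (by gcongr)
    exact_mod_cast lt_of_mul_lt_mul_left this hB0.le
  obtain ⟨ka, ka'⟩ := key x a hx (by rw [hc]; exact le_max_left _ _)
  obtain ⟨kc, kc'⟩ := key s c hs (by rw [hc]; exact le_max_right _ _)
  have sq : ∀ (n m : ℕ) (b : ℤ), 0 < n → √B * |(b : ℝ)| ≤ ε * n → (n : ℝ) ^ 2 * m ≤ B →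
      (m : ℝ) * b ^ 2 ≤ ε ^ 2 := by
    intro n m b hn h1 h2
    have hn' : (0 : ℝ) < n := by exact_mod_cast hn
    have h3 : B * (b : ℝ) ^ 2 ≤ ε ^ 2 * n ^ 2 := by
      have := pow_le_pow_left₀ (by positivity) h1 2
      rwa [mul_pow, mul_pow, Real.sq_sqrt hB0'.le, sq_abs] at this
    have h4 : (n : ℝ) ^ 2 * m * b ^ 2 ≤ B * b ^ 2 := by gcongr
    refine le_of_mul_le_mul_right (a := (n : ℝ) ^ 2) ?_ (by positivity)
    linarith
  rw [abs_of_pos (by linarith [neg_abs_le a])] at h1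
  rw [abs_of_pos (by linarith [neg_abs_le c])] at h2
  exact ⟨G, p, q, x, s, a, c, hG, hp, hq, hx, hs, ka', kc', rat_eq_of_num_den ex ew,
    rat_eq_of_num_den es ez, h1, h2, sq x q a hx ka (b1.trans hH), sq s p c hs kc (b4.trans hH),
    b1.trans hH, b2.trans hH, b3.trans hH, b4.trans hH, ka, kc, hc⟩

lemma ne_of_notMem_specialCurves {P : ℚˣ × ℚˣ} (hP : orbitPoint P ∉ specialCurves)
    {G p q x s : ℕ} {a c : ℤ} (hG : 0 < G) (hx : 0 < x) (hs : 0 < s)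
    (ew : (P.1 : ℚ) * x = x + a) (ez : (P.2 : ℚ) * s = s + c)
    (h1 : (x : ℤ) * (x + a) = p * G) (h2 : (s : ℤ) * (s + c) = q * G) :
    a ≠ 0 ∧ c ≠ 0 ∧ (q : ℤ) * a ^ 2 ≠ p * c ^ 2 := by
  rw [orbitPoint_mem_specialCurves_iff] at hP
  push Not at hP
  obtain ⟨n1, n2, n3, n4⟩ := hP
  have hx' : (x : ℚ) ≠ 0 := by exact_mod_cast hx.ne'
  have hs' : (s : ℚ) ≠ 0 := by exact_mod_cast hs.ne'
  refine ⟨?_, ?_, ?_⟩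
  · rintro rfl
    exact n1 (mul_right_cancel₀ hx' (by rw [ew]; simp))
  · rintro rfl
    exact n2 (mul_right_cancel₀ hs' (by rw [ez]; simp))
  · intro h
    have hG' : (G : ℤ) ≠ 0 := by exact_mod_cast hG.ne'
    -- After multiplication by `G` the difference `q a² - p c²` factors; the factors express `w = z`
    -- and `wz = 1`.
    have h3 : (s * a - x * c : ℤ) * (s * a + x * c + a * c) = 0 := by
      linear_combination G * h + a ^ 2 * h2 - c ^ 2 * h1
    rcases mul_eq_zero.1 h3 with h4 | h4
    · have h4' : (s : ℚ) * a - x * c = 0 := by exact_mod_cast h4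
      refine n4 (mul_right_cancel₀ (mul_ne_zero hx' hs') ?_)
      linear_combination s * ew - x * ez + h4'
    · have h4' : (s : ℚ) * a + x * c + a * c = 0 := by exact_mod_cast h4
      refine n3 (mul_right_cancel₀ (mul_ne_zero hx' hs') ?_)
      linear_combination (P.2 : ℚ) * s * ew + (x + a) * ez + h4'

lemma encard_le_of_injOn_box {α : Type*} {S : Set α} (R : ℕ) (F : α → ℤ × ℤ × ℤ × ℤ × ℤ)
    (hF : Set.InjOn F S) (hb : ∀ P ∈ S, |(F P).1| ≤ R ∧ |(F P).2.1| ≤ R ∧ |(F P).2.2.1| ≤ R ∧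
      |(F P).2.2.2.1| ≤ R ∧ |(F P).2.2.2.2| ≤ R) :
    S.encard ≤ (2 * R + 1) ^ 5 := by
  set I : Finset ℤ := Finset.Icc (-(R : ℤ)) R
  have hmaps : Set.MapsTo F S (I ×ˢ I ×ˢ I ×ˢ I ×ˢ I : Finset (ℤ × ℤ × ℤ × ℤ × ℤ)) := by
    intro P hP
    obtain ⟨h1, h2, h3, h4, h5⟩ := hb P hP
    simp only [I, Finset.coe_product, Set.mem_prod, Finset.mem_coe, Finset.mem_Icc]
    exact ⟨abs_le.1 h1, abs_le.1 h2, abs_le.1 h3, abs_le.1 h4, abs_le.1 h5⟩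
  refine (Set.encard_le_encard_of_injOn hmaps hF).trans ?_
  have hI : I.card = 2 * R + 1 := by
    simp only [I, Int.card_Icc]
    omega
  rw [Set.encard_coe_eq_coe_finsetCard]
  simp only [Finset.card_product, hI]
  exact le_of_eq (by push_cast; ring)

/-- The integers `a, c, p, q` are bounded and fix a Pell conic. On it `m/n` lies within `ε⁵/B` of
`√(p/q)`, while distinct fractions with `n ≤ 3√B` are at least `1/(9B)` apart. So a bounded number
of cells of length `1/(9B)` separates the points. -/
lemma encard_zoomPoints_compl_le {ε : ℝ} (hε : 0 < ε) : ∃ C : ℕ, ∀ B : ℝ, ε < √B →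
    (zoomPoints specialCurvesᶜ ε B).encard ≤ C := by
  set R : ℕ := ⌈ε ^ 2 + 9 * ε ^ 5 + 1⌉₊ with hR
  have hRle : ε ^ 2 + 9 * ε ^ 5 + 1 ≤ (R : ℝ) := Nat.le_ceil _
  refine ⟨(2 * R + 1) ^ 5, fun B hB => ?_⟩
  have hB0 : 0 < √B := hε.trans hB
  have hB0' : 0 < B := Real.sqrt_pos.1 hB0
  choose! G p q x s a c hG hp hq hx hs hax hcs ew ez h1 h2 qa pc b1 b2 b3 b4 ka kc hch using
    fun P (hP : P ∈ zoomPoints specialCurvesᶜ ε B) => zoomPoints_data hB hP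
  have hne := fun P (hP : P ∈ zoomPoints specialCurvesᶜ ε B) =>
    ne_of_notMem_specialCurves hP.1 (hG P hP) (hx P hP) (hs P hP) (ew P hP) (ez P hP)
      (h1 P hP) (h2 P hP)
  set m : ℚˣ × ℚˣ → ℤ := fun P => 2 * x P + a P with hm
  set n : ℚˣ × ℚˣ → ℤ := fun P => 2 * s P + c P with hn
  have hpell : ∀ P ∈ zoomPoints specialCurvesᶜ ε B,
      (q P : ℤ) * m P ^ 2 - p P * n P ^ 2 = q P * a P ^ 2 - p P * c P ^ 2 := fun P hP => by
    simp only [hm, hn]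
    linear_combination 4 * (q P : ℤ) * h1 P hP - 4 * (p P : ℤ) * h2 P hP
  have hmpos : ∀ P ∈ zoomPoints specialCurvesᶜ ε B, 0 < m P := fun P hP => by
    have := hax P hP
    have := neg_abs_le (a P)
    simp only [hm]
    linarith
  have hnbd : ∀ P ∈ zoomPoints specialCurvesᶜ ε B,
      √B ≤ ε * n P ∧ (n P : ℝ) ≤ 3 * √B ∧ 0 < n P := fun P hP => by
    have l1 := hcs P hP
    have l2 := neg_abs_le (c P)
    have l3 : (s P : ℤ) ≤ n P := by
      simp only [hn]
      linarith
    have l4 : n P ≤ 3 * s P := by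
      simp only [hn]
      linarith [le_abs_self (c P)]
    have l5 : (s P : ℝ) ≤ √B := by
      apply Real.le_sqrt_of_sq_le
      have : (1 : ℝ) ≤ p P := by exact_mod_cast hp P hP
      exact (le_mul_of_one_le_right (sq_nonneg _) this).trans (b4 P hP)
    have l6 : (1 : ℝ) ≤ |(c P : ℝ)| := by exact_mod_cast Int.one_le_abs (hne P hP).2.1
    have l3' : (s P : ℝ) ≤ n P := by exact_mod_cast l3
    have l4' : (n P : ℝ) ≤ 3 * s P := by exact_mod_cast l4
    refine ⟨?_, by linarith, ?_⟩
    · calc √B ≤ √B * |(c P : ℝ)| := le_mul_of_one_le_right hB0.le l6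
        _ ≤ ε * s P := kc P hP
        _ ≤ ε * n P := by gcongr
    · have := hs P hP
      omega
  -- The index of the cell of length `1/(9B)` containing `m/n`, counted from `√(p/q)`.
  set k : ℚˣ × ℚˣ → ℤ := fun P => ⌊9 * B * ((m P : ℝ) / n P - √((p P : ℝ) / q P))⌋ with hk
  have habs : ∀ (b : ℤ) (e : ℕ), 0 < e → (e : ℝ) * b ^ 2 ≤ ε ^ 2 → |b| ≤ R := by
    intro b e he hb
    have he' : (1 : ℝ) ≤ e := by exact_mod_cast he
    have hb2 : (|(b : ℝ)|) ≤ (b : ℝ) ^ 2 := by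
      have : |b| ≤ b ^ 2 := by
        rw [← sq_abs]
        exact Int.le_self_sq |b|
      exact_mod_cast this
    have : |(b : ℝ)| ≤ R := by
      have : 0 ≤ 9 * ε ^ 5 := by positivity
      linarith [le_mul_of_one_le_left (sq_nonneg (b : ℝ)) he']
    exact_mod_cast this
  have hnat : ∀ (b : ℤ) (e : ℕ), b ≠ 0 → (e : ℝ) * b ^ 2 ≤ ε ^ 2 → (e : ℝ) ≤ ε ^ 2 := by
    intro b e hb h
    have : (1 : ℝ) ≤ (b : ℝ) ^ 2 := by
      have h0 : 0 < b ^ 2 := by positivity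
      have : 1 ≤ b ^ 2 := by linarith
      exact_mod_cast this
    exact (le_mul_of_one_le_right (Nat.cast_nonneg e) this).trans h
  refine (encard_le_of_injOn_box R (fun P => (a P, c P, p P, q P, k P)) ?_ ?_).trans
    (by exact_mod_cast le_rfl)
  · intro P hP P' hP' hPP'
    simp only [Prod.mk.injEq, Nat.cast_inj] at hPP'
    obtain ⟨ea, ec, ep, eq, ek⟩ := hPP'
    obtain ⟨-, n2, n3⟩ := hnbd P hP
    obtain ⟨-, n2', n3'⟩ := hnbd P' hP'
    have n3r : (0 : ℝ) < n P := by exact_mod_cast n3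
    have n3r' : (0 : ℝ) < n P' := by exact_mod_cast n3'
    have hlt := Int.abs_sub_lt_one_of_floor_eq_floor ek
    rw [ep, eq, ← mul_sub, sub_sub_sub_cancel_right, abs_mul, abs_of_pos (by positivity),
      div_sub_div _ _ n3r.ne' n3r'.ne', abs_div, abs_of_pos (mul_pos n3r n3r'), ← mul_div_assoc,
      div_lt_one (by positivity)] at hlt
    have hnn : (n P : ℝ) * n P' ≤ 9 * B := by
      calc (n P : ℝ) * n P' ≤ (3 * √B) * (3 * √B) := by gcongr
        _ = 9 * B := by rw [mul_mul_mul_comm, Real.mul_self_sqrt hB0'.le]; norm_num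
    -- Two fractions in one cell differ by less than `1/(9B) ≤ 1/(n n')`, so the integer determinant
    -- vanishes.
    have hcross : m P * n P' - n P * m P' = 0 := by
      have : |(m P : ℝ) * n P' - n P * m P'| < 1 := by
        refine lt_of_mul_lt_mul_left (a := 9 * B) ?_ (by positivity)
        linarith
      exact Int.abs_lt_one_iff.1 (by exact_mod_cast this)
    have p1 := hpell P hP
    have p2 := hpell P' hP'
    rw [ea, ec, ep, eq] at p1
    -- Proportional solutions with the same nonzero right-hand side have equal `n²`.
    have hE : (q P' : ℤ) * a P' ^ 2 - p P' * c P' ^ 2 ≠ 0 := sub_ne_zero.2 (hne P' hP').2.2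
    have hn2 : n P ^ 2 = n P' ^ 2 := by
      have : ((q P' : ℤ) * a P' ^ 2 - p P' * c P' ^ 2) * (n P ^ 2 - n P' ^ 2) = 0 := by
        linear_combination -n P ^ 2 * p2 + n P' ^ 2 * p1 -
          q P' * (m P * n P' + n P * m P') * hcross
      linarith [(mul_eq_zero.1 this).resolve_left hE]
    have hnn' : n P = n P' := (sq_eq_sq₀ n3.le n3'.le).1 hn2
    have hmm' : m P = m P' := by
      rw [hnn', mul_comm (n P'), ← sub_mul] at hcross
      linarith [(mul_eq_zero.1 hcross).resolve_right n3'.ne']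
    have exx : x P = x P' := by
      simp only [hm, ea] at hmm'
      omega
    have ess : s P = s P' := by
      simp only [hn, ec] at hnn'
      omega
    have w1 := ew P hP
    have w2 := ez P hP
    rw [exx, ea, ← ew P' hP'] at w1
    rw [ess, ec, ← ez P' hP'] at w2
    have hx0 : (x P' : ℚ) ≠ 0 := by exact_mod_cast (hx P' hP').ne'
    have hs0 : (s P' : ℚ) ≠ 0 := by exact_mod_cast (hs P' hP').ne'
    exact Prod.ext (Units.ext (mul_right_cancel₀ hx0 w1)) (Units.ext (mul_right_cancel₀ hs0 w2))
  · intro P hP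
    have pR := hnat (c P) (p P) (hne P hP).2.1 (pc P hP)
    have qR := hnat (a P) (q P) (hne P hP).1 (qa P hP)
    have h5 : 0 ≤ 9 * ε ^ 5 := by positivity
    refine ⟨habs _ _ (hq P hP) (qa P hP), habs _ _ (hp P hP) (pc P hP), ?_, ?_, ?_⟩
    · simp only [Nat.abs_cast]
      have : (p P : ℝ) ≤ R := by linarith
      exact_mod_cast this
    · simp only [Nat.abs_cast]
      have : (q P : ℝ) ≤ R := by linarith
      exact_mod_cast this
    · obtain ⟨n1, n2, n3⟩ := hnbd P hP
      have n3r : (0 : ℝ) < n P := by exact_mod_cast n3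
      have m3r : (0 : ℝ) < m P := by exact_mod_cast hmpos P hP
      have hp1 : (1 : ℝ) ≤ p P := by exact_mod_cast hp P hP
      have hq1 : (1 : ℝ) ≤ q P := by exact_mod_cast hq P hP
      set θ := √((p P : ℝ) / q P) with hθ
      have hθ2 : θ ^ 2 = (p P : ℝ) / q P := Real.sq_sqrt (by positivity)
      have hθε : 1 / ε ≤ θ := by
        apply Real.le_sqrt_of_sq_le
        rw [div_pow, one_pow]
        gcongr
      have hpr : (q P : ℝ) * m P ^ 2 - p P * n P ^ 2 = q P * a P ^ 2 - p P * c P ^ 2 := by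
        exact_mod_cast hpell P hP
      have hEle : |(q P : ℝ) * a P ^ 2 - p P * c P ^ 2| ≤ ε ^ 2 := by
        have hqa : (0 : ℝ) ≤ q P * a P ^ 2 := by positivity
        have hpc : (0 : ℝ) ≤ p P * c P ^ 2 := by positivity
        exact abs_le.2 ⟨by linarith [pc P hP], by linarith [qa P hP]⟩
      -- Divide the Pell equation by `q n²` and factor its left side; the sum factor is at least `θ
      -- ≥ 1/ε`, and `n ≥ √B/ε`.
      have hdiff : |(m P : ℝ) / n P - θ| ≤ ε ^ 5 / B := by
        have e1 : ((m P : ℝ) / n P - θ) * ((m P : ℝ) / n P + θ) =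
            (q P * a P ^ 2 - p P * c P ^ 2) / (q P * n P ^ 2) := by
          rw [← hpr]
          have : ((m P : ℝ) / n P - θ) * ((m P : ℝ) / n P + θ) = ((m P : ℝ) / n P) ^ 2 - θ ^ 2 := by
            ring
          rw [this, hθ2]
          field_simp
        have e2 : |(m P : ℝ) / n P - θ| * ((m P : ℝ) / n P + θ) ≤ ε ^ 4 / B := by
          have hpos : 0 < (m P : ℝ) / n P + θ := by positivity
          rw [← abs_of_pos hpos, ← abs_mul, e1, abs_div, abs_of_pos (by positivity :
            (0 : ℝ) < q P * n P ^ 2), div_le_div_iff₀ (by positivity) hB0']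
          have : B ≤ ε ^ 2 * n P ^ 2 := by
            have := pow_le_pow_left₀ hB0.le n1 2
            rwa [Real.sq_sqrt hB0'.le, mul_pow] at this
          calc _ ≤ ε ^ 2 * (ε ^ 2 * n P ^ 2) := by gcongr
            _ = ε ^ 4 * (1 * n P ^ 2) := by ring
            _ ≤ _ := by gcongr
        have e3 : 1 / ε ≤ (m P : ℝ) / n P + θ := by
          have : 0 ≤ (m P : ℝ) / n P := by positivity
          linarith
        have e4 : |(m P : ℝ) / n P - θ| * (1 / ε) ≤ ε ^ 4 / B :=
          (mul_le_mul_of_nonneg_left e3 (abs_nonneg _)).trans e2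
        rw [mul_one_div, div_le_iff₀ hε] at e4
        exact e4.trans_eq (by ring)
      have hu : |9 * B * ((m P : ℝ) / n P - θ)| ≤ 9 * ε ^ 5 := by
        rw [abs_mul, abs_of_pos (by positivity)]
        calc _ ≤ 9 * B * (ε ^ 5 / B) := by gcongr
          _ = 9 * ε ^ 5 := by field_simp
      have f1 := Int.floor_le (9 * B * ((m P : ℝ) / n P - θ))
      have f2 := Int.lt_floor_add_one (9 * B * ((m P : ℝ) / n P - θ))
      obtain ⟨u1, u2⟩ := abs_le.1 hu
      have : |(k P : ℝ)| ≤ R := by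
        rw [abs_le]
        simp only [hk]
        constructor <;> linarith [sq_nonneg ε]
      exact_mod_cast this

/-! ### Points on the special curves -/

lemma zoomPoints_mono {A A' : Set Y4} (h : A ⊆ A') (ε B : ℝ) :
    zoomPoints A ε B ⊆ zoomPoints A' ε B := fun _ hP => ⟨h hP.1, hP.2⟩

/-- One coordinate determines the point, and its denominator is at most `√B`. The distance condition
then gives `|a| ≤ ε`, leaving boundedly many numerators per denominator. -/
lemma encard_zoomPoints_specialCurve_le (i : Fin 4) {ε B : ℝ} (hB : ε < √B) (hε : 0 < ε) :
    (zoomPoints (specialCurve i) ε B).encard ≤ ((⌊√B⌋₊ * (2 * ⌈ε⌉₊ + 1) : ℕ) : ℕ∞) := by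
  have hB0 : 0 < √B := hε.trans hB
  have main : ∀ u : ℚˣ × ℚˣ → ℚ, Set.InjOn u (zoomPoints (specialCurve i) ε B) →
      (∀ P ∈ zoomPoints (specialCurve i) ε B, ∃ (x : ℕ) (a : ℤ), 0 < x ∧ u P * x = x + a ∧
        (x : ℝ) ≤ √B ∧ √B * |(a : ℝ)| ≤ ε * x) →
      (zoomPoints (specialCurve i) ε B).encard ≤ ((⌊√B⌋₊ * (2 * ⌈ε⌉₊ + 1) : ℕ) : ℕ∞) := by
    intro u hu h
    choose! x a hx hxa hxB ha using h
    have hmaps : Set.MapsTo (fun P => (x P, a P)) (zoomPoints (specialCurve i) ε B)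
        (Finset.Icc 1 ⌊√B⌋₊ ×ˢ Finset.Icc (-(⌈ε⌉₊ : ℤ)) ⌈ε⌉₊ : Finset (ℕ × ℤ)) := by
      intro P hP
      simp only [Finset.coe_product, Set.mem_prod, Finset.mem_coe, Finset.mem_Icc]
      refine ⟨⟨hx P hP, Nat.le_floor (hxB P hP)⟩, abs_le.1 ?_⟩
      have h1 : √B * |(a P : ℝ)| ≤ √B * ε := by
        calc _ ≤ ε * x P := ha P hP
          _ ≤ ε * √B := by gcongr; exact hxB P hP
          _ = _ := mul_comm _ _
      have h2 : |(a P : ℝ)| ≤ ⌈ε⌉₊ := (le_of_mul_le_mul_left h1 hB0).trans (Nat.le_ceil _)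
      exact_mod_cast h2
    refine (Set.encard_le_encard_of_injOn hmaps ?_).trans ?_
    · intro P hP P' hP' e
      simp only [Prod.mk.injEq] at e
      apply hu hP hP'
      have h1 := hxa P hP
      rw [e.1, e.2, ← hxa P' hP'] at h1
      exact mul_right_cancel₀ (by exact_mod_cast (hx P' hP').ne') h1
    · rw [Set.encard_coe_eq_coe_finsetCard, Finset.card_product, Nat.card_Icc, Int.card_Icc]
      apply le_of_eq
      congr 2
      omega
  have hle : ∀ n m : ℕ, 0 < m → (n : ℝ) ^ 2 * m ≤ B → (n : ℝ) ≤ √B := by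
    intro n m hm h
    apply Real.le_sqrt_of_sq_le
    have : (1 : ℝ) ≤ m := by exact_mod_cast hm
    nlinarith [sq_nonneg (n : ℝ)]
  have hmem : ∀ P ∈ zoomPoints (specialCurve i) ε B,
      ![(P.1 : ℚ), P.2, P.1 * P.2, P.1 / P.2] i = 1 :=
    fun P hP => (orbitPoint_mem_specialCurve_iff P i).1 hP.1
  by_cases hi : i = 0
  · subst hi
    refine main (fun P => P.2) (fun P hP P' hP' e => ?_) fun P hP => ?_
    · have h1 := hmem P hP
      have h2 := hmem P' hP'
      simp only [Matrix.cons_val] at h1 h2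
      exact Prod.ext (Units.ext (h1.trans h2.symm)) (Units.ext e)
    · obtain ⟨G, p, q, x, s, a, c, -, hp, -, -, hs, -, -, -, ez, -, -, -, -, -, -, -, b4, -, kc, -⟩ :=
        zoomPoints_data hB hP
      exact ⟨s, c, hs, ez, hle s p hp b4, kc⟩
  · refine main (fun P => P.1) (fun P hP P' hP' e => ?_) fun P hP => ?_
    · have h1 := hmem P hP
      have h2 := hmem P' hP'
      refine Prod.ext (Units.ext e) (Units.ext ?_)
      have e : (P.1 : ℚ) = P'.1 := e
      have p1 := P'.1.ne_zero
      have p2 := P.2.ne_zero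
      have p2' := P'.2.ne_zero
      fin_cases i <;> simp only [Matrix.cons_val, Fin.zero_eta, Fin.mk_one, Fin.reduceFinMk] at h1 h2
      · exact absurd rfl hi
      · rw [h1, h2]
      · rw [e, ← h2] at h1
        exact mul_left_cancel₀ p1 h1
      · rw [div_eq_one_iff_eq p2] at h1
        rw [div_eq_one_iff_eq p2'] at h2
        rw [← h1, ← h2, e]
    · obtain ⟨G, p, q, x, s, a, c, -, -, hq, hx, -, -, -, ew, -, -, -, -, -, b1, -, -, -, ka, -, -⟩ :=
        zoomPoints_data hB hP
      exact ⟨x, a, hx, ew, hle x q hq b1, ka⟩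

lemma exists_encard_zoomPoints_univ_le {ε : ℝ} (hε : 0 < ε) : ∃ C : ℕ, ∀ B : ℝ, ε < √B → 1 ≤ B →
    ((zoomPoints Set.univ ε B).encard : ℝ≥0∞) ≤ ENNReal.ofReal (C * √B) := by
  obtain ⟨C, hC⟩ := encard_zoomPoints_compl_le hε
  refine ⟨C + 4 * (2 * ⌈ε⌉₊ + 1), fun B hB hB1 => ?_⟩
  have hB1' : 1 ≤ √B := by rwa [Real.one_le_sqrt]
  have hsub : zoomPoints Set.univ ε B ⊆ zoomPoints specialCurvesᶜ ε B ∪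
      (zoomPoints (specialCurve 0) ε B ∪ (zoomPoints (specialCurve 1) ε B ∪
      (zoomPoints (specialCurve 2) ε B ∪ zoomPoints (specialCurve 3) ε B))) := by
    intro P hP
    by_cases h : orbitPoint P ∈ specialCurves
    · obtain ⟨i, hi⟩ := Set.mem_iUnion.1 h
      have : P ∈ zoomPoints (specialCurve i) ε B := ⟨hi, hP.2⟩
      fin_cases i
      · exact Or.inr (Or.inl this)
      · exact Or.inr (Or.inr (Or.inl this))
      · exact Or.inr (Or.inr (Or.inr (Or.inl this)))
      · exact Or.inr (Or.inr (Or.inr (Or.inr this)))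
    · exact Or.inl ⟨h, hP.2⟩
  have h2 : (zoomPoints Set.univ ε B).encard ≤
      ((C + 4 * (⌊√B⌋₊ * (2 * ⌈ε⌉₊ + 1)) : ℕ) : ℕ∞) := by
    have hi := fun i => encard_zoomPoints_specialCurve_le i hB hε
    calc _ ≤ _ := Set.encard_le_encard hsub
      _ ≤ _ := (Set.encard_union_le _ _).trans (add_le_add (hC B hB)
          ((Set.encard_union_le _ _).trans (add_le_add (hi 0)
          ((Set.encard_union_le _ _).trans (add_le_add (hi 1)
          ((Set.encard_union_le _ _).trans (add_le_add (hi 2) (hi 3))))))))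
      _ = _ := by push_cast; ring
  calc ((zoomPoints Set.univ ε B).encard : ℝ≥0∞)
      ≤ (((C + 4 * (⌊√B⌋₊ * (2 * ⌈ε⌉₊ + 1)) : ℕ) : ℕ∞) : ℝ≥0∞) := by exact_mod_cast h2
    _ = ENNReal.ofReal ((C + 4 * (⌊√B⌋₊ * (2 * ⌈ε⌉₊ + 1)) : ℕ) : ℝ) := by
        rw [ENNReal.ofReal_natCast]
        rfl
    _ ≤ _ := by
        apply ENNReal.ofReal_le_ofReal
        have h3 : (⌊√B⌋₊ : ℝ) ≤ √B := Nat.floor_le (Real.sqrt_nonneg B)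
        push_cast
        have : (C : ℝ) ≤ C * √B := le_mul_of_one_le_right (Nat.cast_nonneg _) hB1'
        have h4 : (⌊√B⌋₊ : ℝ) * (2 * ⌈ε⌉₊ + 1) ≤ √B * (2 * ⌈ε⌉₊ + 1) := by gcongr
        linarith

/-- The points with `√B/2 ≤ n ≤ √B - 2` all qualify: their height is at most `(n + 2)² ≤ B` and
their rescaled distance at most `√B/(n + 1) ≤ 2`. -/
lemma le_encard_zoomPoints_of_specialPoint {A : Set Y4} {i : Fin 4} {J : ℕ}
    (hJ : ∀ n, J ≤ n → orbitPoint (specialPoint i n) ∈ A) {ε B : ℝ} (hε : 2 ≤ ε)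
    (hB : 2 * (J : ℝ) ≤ √B) (hB1 : 1 ≤ B) :
    ENNReal.ofReal (√B / 2 - 3) ≤ ((zoomPoints A ε B).encard : ℝ≥0∞) := by
  have hB1' : 1 ≤ √B := by rwa [Real.one_le_sqrt]
  set I := Finset.Ico ⌈√B / 2⌉₊ (⌊√B⌋₊ - 1) with hI
  have hmaps : Set.MapsTo (specialPoint i) I (zoomPoints A ε B) := by
    intro n hn
    simp only [hI, Finset.mem_coe, Finset.mem_Ico] at hn
    have h1 : √B / 2 ≤ n := Nat.ceil_le.1 hn.1
    have h2 : (n : ℝ) + 2 ≤ √B := by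
      have : n + 2 ≤ ⌊√B⌋₊ := by omega
      have := (Nat.cast_le (α := ℝ)).2 this
      push_cast at this
      exact this.trans (Nat.floor_le (Real.sqrt_nonneg B))
    refine ⟨hJ n ?_, ?_, ?_⟩
    · have : (J : ℝ) ≤ n := by linarith
      exact_mod_cast this
    · calc _ ≤ ((n : ℝ) + 2) ^ 2 := height_specialPoint i n
        _ ≤ √B ^ 2 := by gcongr
        _ = B := Real.sq_sqrt (by linarith)
    · calc _ ≤ √B * (1 / ((n : ℝ) + 1)) := by gcongr; exact norm_chart_specialPoint i n
        _ ≤ 2 := by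
          rw [mul_one_div, div_le_iff₀ (by positivity)]
          linarith
        _ ≤ ε := hε
  have hcard : (I.card : ℕ∞) ≤ (zoomPoints A ε B).encard := by
    rw [← Set.encard_coe_eq_coe_finsetCard]
    exact Set.encard_le_encard_of_injOn hmaps (specialPoint_injective i).injOn
  calc ENNReal.ofReal (√B / 2 - 3) ≤ ENNReal.ofReal (I.card : ℝ) := by
        apply ENNReal.ofReal_le_ofReal
        rw [hI, Nat.card_Ico]
        have h1 := Nat.ceil_lt_add_one (by positivity : 0 ≤ √B / 2)
        have h2 := Nat.lt_floor_add_one √B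
        -- With truncated subtraction this also covers an empty interval.
        have h3 : ⌊√B⌋₊ ≤ (⌊√B⌋₊ - 1 - ⌈√B / 2⌉₊) + 1 + ⌈√B / 2⌉₊ := by omega
        have h3 := (Nat.cast_le (α := ℝ)).2 h3
        push_cast [-Nat.cast_sub] at h3
        linarith
    _ = ((I.card : ℕ∞) : ℝ≥0∞) := by
        rw [ENNReal.ofReal_natCast]
        rfl
    _ ≤ _ := by exact_mod_cast hcard

/-! ### Weak accumulation along the special curves -/

lemma exists_specialPoint_notMem {W : Set Y4} (hW : IsZariskiClosed W) {i : Fin 4}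
    (hi : ¬ specialCurve i ⊆ W) : ∃ J : ℕ, ∀ n, J ≤ n → orbitPoint (specialPoint i n) ∈ Wᶜ := by
  have hfin : {n | orbitPoint (specialPoint i n) ∈ W}.Finite := by
    by_contra h
    exact hi (specialCurve_subset_of_infinite hW i _ (isCoords_specialPoint i) h)
  obtain ⟨b, hb⟩ := hfin.bddAbove
  refine ⟨b + 1, fun n hn h => ?_⟩
  have := hb h
  omega

/-- A set of points off the special curves is negligible in the zoom with respect to any set that
contains almost all points of one of these curves. -/
lemma eventually_compl_le_of_specialPoint {A : Set Y4} {i : Fin 4} {J : ℕ}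
    (hJ : ∀ n, J ≤ n → orbitPoint (specialPoint i n) ∈ A) {ε : ℝ} (hε : 2 ≤ ε) {c : ℝ≥0}
    (hc : 0 < c) : ∀ᶠ B : ℝ in atTop, zoomMeasure specialCurvesᶜ B 2 (Metric.closedBall 0 ε) ≤
      c * zoomMeasure A B 2 (Metric.closedBall 0 ε) := by
  obtain ⟨C, hC⟩ := encard_zoomPoints_compl_le (by linarith : 0 < ε)
  have hs := Real.tendsto_sqrt_atTop
  filter_upwards [eventually_ge_atTop 1, hs.eventually_gt_atTop ε,
    hs.eventually_ge_atTop (2 * (J : ℝ)), hs.eventually_ge_atTop (2 * (C / c + 3))]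
    with B h1 h2 h3 h4
  rw [zoomMeasure_closedBall, zoomMeasure_closedBall]
  calc ((zoomPoints specialCurvesᶜ ε B).encard : ℝ≥0∞) ≤ ((C : ℕ∞) : ℝ≥0∞) := by
        exact_mod_cast hC B h2
    _ = ENNReal.ofReal (C : ℝ) := by rw [ENNReal.ofReal_natCast]; rfl
    _ ≤ ENNReal.ofReal (c * (√B / 2 - 3)) := by
        apply ENNReal.ofReal_le_ofReal
        have hc' : (0 : ℝ) < c := hc
        rw [mul_comm, ← div_le_iff₀ hc']
        linarith
    _ = c * ENNReal.ofReal (√B / 2 - 3) := by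
        rw [ENNReal.ofReal_mul (NNReal.coe_nonneg c), ENNReal.ofReal_coe_nnreal]
    _ ≤ _ := by
        gcongr
        exact le_encard_zoomPoints_of_specialPoint hJ hε h3 h1

lemma zoomMeasure_mono {A A' : Set Y4} (h : A ⊆ A') (B ε : ℝ) :
    zoomMeasure A B 2 (Metric.closedBall 0 ε) ≤ zoomMeasure A' B 2 (Metric.closedBall 0 ε) := by
  rw [zoomMeasure_closedBall, zoomMeasure_closedBall]
  exact_mod_cast Set.encard_le_encard (zoomPoints_mono h ε B)

lemma specialCurves_ne_univ : specialCurves ≠ Set.univ := by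
  intro h
  have := (orbitPoint_mem_specialCurves_iff (Units.mk0 2 (by norm_num), Units.mk0 3 (by norm_num))).1
    (h ▸ Set.mem_univ _)
  norm_num at this

lemma isLocallyWeaklyAccumulating_specialCurves : IsLocallyWeaklyAccumulating specialCurves := by
  refine ⟨isZariskiClosed_specialCurves, specialCurves_ne_univ, by simp [essentialConst_eq],
    by rw [essentialConst_eq, approxConst_specialCurves], 2, two_pos, ?_⟩
  intro ε hε U hU _ hdense c hc
  rw [essentialConst_eq, ENNReal.toReal_ofNat]
  -- Otherwise `U ∩ specialCurves` would lie in the union of the other three curves, which is closed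
  -- and misses the point `w = 1`, `z = 2`.
  have hnot : ¬ specialCurve 0 ⊆ Uᶜ := by
    intro hsub
    have h1 := hdense.2 _ (isZariskiClosed_iUnion_specialCurve {1, 2, 3}) (by
      rintro P ⟨hPU, hP⟩
      obtain ⟨i, hi⟩ := Set.mem_iUnion.1 hP
      have hi0 : i ≠ 0 := by
        rintro rfl
        exact hsub hi hPU
      refine Set.mem_biUnion (x := i) ?_ hi
      fin_cases i <;> simp_all)
    have h2 := h1 (Set.mem_iUnion.2 ⟨0, (orbitPoint_mem_specialCurve_iff
      (Units.mk0 1 (by norm_num), Units.mk0 2 (by norm_num)) 0).2 (by simp)⟩)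
    simp only [Set.mem_iUnion] at h2
    obtain ⟨i, hi, h3⟩ := h2
    rw [orbitPoint_mem_specialCurve_iff] at h3
    simp only [Finset.mem_insert, Finset.mem_singleton] at hi
    rcases hi with rfl | rfl | rfl <;> simp at h3
  obtain ⟨J, hJ⟩ := exists_specialPoint_notMem hU.1 hnot
  have := eventually_compl_le_of_specialPoint (A := U ∩ specialCurves) (i := 0) (J := J)
    (fun n hn => ⟨by simpa using hJ n hn, Set.mem_iUnion.2 ⟨0, orbitPoint_specialPoint_mem 0 n⟩⟩)
    hε hc
  filter_upwards [this] with B hB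
  exact (zoomMeasure_mono (fun P hP => hP.2) B ε).trans hB

/-- If `W` misses a special curve generically, then with `U = Y4` the points outside `W` already
number at least `√B/2 - 3`, while all points together number at most `C√B`. The first count is not
negligible. -/
lemma specialCurves_subset_of_isLocallyWeaklyAccumulating {W : Set Y4}
    (hW : IsLocallyWeaklyAccumulating W) : specialCurves ⊆ W := by
  obtain ⟨hcl, -, -, -, ε₀, hε₀, h⟩ := hW
  by_contra hsub
  obtain ⟨i, hi⟩ : ∃ i, ¬ specialCurve i ⊆ W := by
    by_contra! hall
    exact hsub (Set.iUnion_subset hall)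
  obtain ⟨J, hJ⟩ := exists_specialPoint_notMem hcl hi
  set ε := max ε₀ 2 with hε
  have hε2 : 2 ≤ ε := le_max_right _ _
  obtain ⟨C, hC⟩ := exists_encard_zoomPoints_univ_le (by linarith : 0 < ε)
  -- The factor turns the upper bound `C√B` into at most `√B/4`, which is less than `√B/2 - 3` once
  -- `√B > 12`.
  have h1 := h ε (le_max_left _ _) Set.univ isDenseOpen_univ
    (by rw [essentialConst_eq, isDenseOpen_univ.approxConst_eq])
    ⟨Set.inter_subset_right, fun F _ hF => by rwa [Set.univ_inter] at hF⟩ (1 / (4 * (C + 1)))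
    (by positivity)
  rw [essentialConst_eq, ENNReal.toReal_ofNat] at h1
  have hs := Real.tendsto_sqrt_atTop
  obtain ⟨B, h1, h2, h3, h4, h5⟩ := (h1.and ((eventually_ge_atTop 1).and
    ((hs.eventually_gt_atTop ε).and ((hs.eventually_ge_atTop (2 * (J : ℝ))).and
      (hs.eventually_gt_atTop 12))))).exists
  have hlow := le_encard_zoomPoints_of_specialPoint hJ hε2 h4 h2
  have hup := hC B h3 h2
  rw [← zoomMeasure_closedBall] at hlow hup
  have : ENNReal.ofReal (√B / 2 - 3) ≤ ENNReal.ofReal (√B / 4) := by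
    calc _ ≤ _ := hlow
      _ ≤ _ := zoomMeasure_mono (A' := Set.univ \ W) (fun P hP => ⟨Set.mem_univ _, hP⟩) B ε
      _ ≤ _ := h1
      _ ≤ ((1 / (4 * (C + 1)) : ℝ≥0) : ℝ≥0∞) * ENNReal.ofReal (C * √B) := by
          gcongr
          exact (zoomMeasure_mono (Set.subset_univ _) B ε).trans hup
      _ = ENNReal.ofReal ((1 / (4 * (C + 1)) : ℝ≥0) * (C * √B)) := by
          rw [ENNReal.ofReal_mul (NNReal.coe_nonneg _), ENNReal.ofReal_coe_nnreal]
      _ ≤ _ := by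
          apply ENNReal.ofReal_le_ofReal
          push_cast
          have hC0 : (0 : ℝ) < 4 * (C + 1) := by positivity
          rw [one_div, inv_mul_le_iff₀ hC0]
          nlinarith [Real.sqrt_nonneg B]
  rw [ENNReal.ofReal_le_ofReal_iff (by positivity)] at this
  linarith

/-! ### The nodal curves -/

/-- The coefficients of the nodal curve through a point of the zoom are bounded, and they are not
both squares. -/
lemma nodal_coefficients {ε B : ℝ} (hε : 0 < ε) (hB : ε < √B) (hB5 : ε ^ 5 < √B) {P : ℚˣ × ℚˣ}
    (hP : P ∈ zoomPoints specialCurvesᶜ ε B) {α β : ℕ} (hα : 0 < α) (hβ : 0 < β)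
    (hcop : α.Coprime β)
    (h : (β : ℚ) * P.2 * (P.1 - 1) ^ 2 = α * P.1 * (P.2 - 1) ^ 2) :
    (β : ℝ) ≤ ε ^ 2 ∧ ¬ (IsSquare α ∧ IsSquare β) := by
  obtain ⟨G, p, q, x, s, a, c, hG, hp, hq, hx, hs, hax, hcs, ew, ez, h1, h2, qa, pc, -, -, -, -, -,
    kc, -⟩ := zoomPoints_data hB hP
  obtain ⟨ha, hc, hne⟩ := ne_of_notMem_specialCurves hP.1 hG hx hs ew ez h1 h2
  have hx0 : (x : ℚ) ≠ 0 := by exact_mod_cast hx.ne'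
  have hs0 : (s : ℚ) ≠ 0 := by exact_mod_cast hs.ne'
  have hG0 : (G : ℚ) ≠ 0 := by exact_mod_cast hG.ne'
  have hrel : (β : ℤ) * q * a ^ 2 = α * p * c ^ 2 := by
    have h1' : (x : ℚ) * (x + a) = p * G := by exact_mod_cast h1
    have h2' : (s : ℚ) * (s + c) = q * G := by exact_mod_cast h2
    have ew' : (P.1 : ℚ) = (x + a) / x := by rw [eq_div_iff hx0, ew]
    have ez' : (P.2 : ℚ) = (s + c) / s := by rw [eq_div_iff hs0, ez]
    rw [ew', ez', add_div, add_div, div_self hx0, div_self hs0, add_sub_cancel_left,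
      add_sub_cancel_left] at h
    field_simp at h
    have : (β : ℚ) * q * a ^ 2 = α * p * c ^ 2 := by
      apply mul_left_cancel₀ hG0
      linear_combination h - β * a ^ 2 * h2' + α * c ^ 2 * h1'
    exact_mod_cast this
  constructor
  -- Since `α` and `β` are coprime, `β` divides the positive integer `p c²`, which the zoom bounds
  -- by `ε²`.
  · have hdvd : (β : ℤ) ∣ p * c ^ 2 := by
      have : (β : ℤ) ∣ α * (p * c ^ 2) := ⟨q * a ^ 2, by linear_combination -hrel⟩
      exact (Nat.isCoprime_iff_coprime.2 hcop.symm).dvd_of_dvd_mul_left this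
    have hle : (β : ℤ) ≤ p * c ^ 2 := Int.le_of_dvd (by positivity) hdvd
    have hle' : (β : ℝ) ≤ p * c ^ 2 := by exact_mod_cast hle
    exact hle'.trans pc
  · rintro ⟨⟨u, rfl⟩, v, rfl⟩
    have hv0 : (v : ℤ) * a ≠ 0 := mul_ne_zero (by rintro h0; simp_all) ha
    -- When `α = u²` and `β = v²`, the relation gives `(u c p)² = p q (v a)²`, so `p q` is the
    -- square of an integer `r`.
    obtain ⟨r, hr⟩ : (v : ℤ) * a ∣ u * c * p := by
      rw [← Int.pow_dvd_pow_iff two_ne_zero]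
      refine ⟨p * q, ?_⟩
      push_cast at hrel
      linear_combination -(p : ℤ) * hrel
    have hr2 : r ^ 2 = p * q := by
      apply mul_left_cancel₀ (pow_ne_zero 2 hv0)
      rw [← mul_pow, ← hr]
      push_cast at hrel
      linear_combination -(p : ℤ) * hrel
    set m : ℤ := 2 * x + a with hm
    set n : ℤ := 2 * s + c with hn
    have hpell : (q * m - |r| * n) * (q * m + |r| * n) = q * (q * a ^ 2 - p * c ^ 2) := by
      have : (|r|) ^ 2 = p * q := by rw [sq_abs, hr2]
      rw [hm, hn]
      linear_combination 4 * (q : ℤ) ^ 2 * h1 - 4 * (p : ℤ) * q * h2 - (2 * (s : ℤ) + c) ^ 2 * this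
    have hm0 : 0 < m := by linarith [neg_abs_le a]
    have hsn : (s : ℤ) < n := by linarith [neg_abs_le c]
    have hr0 : r ≠ 0 := by
      rintro rfl
      have : 0 < (p : ℤ) * q := by positivity
      simp at hr2
      omega
    have hq' : (0 : ℤ) < q := by exact_mod_cast hq
    have hE : (1 : ℤ) ≤ |q * m - |r| * n| := by
      apply Int.one_le_abs
      intro h0
      rw [h0, zero_mul] at hpell
      exact (mul_ne_zero hq'.ne' (sub_ne_zero.2 hne)) hpell.symm
    have hr1 := Int.one_le_abs hr0
    have hs' : (0 : ℤ) < s := by exact_mod_cast hs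
    have hn0 : 0 < n := hs'.trans hsn
    have hsum : n ≤ q * m + |r| * n := by
      linarith [mul_pos hq' hm0, le_mul_of_one_le_left hn0.le hr1]
    -- The Pell form now splits over the integers. One factor is at least 1 in absolute value and
    -- the other at least `n`, so `n ≤ ε⁴`; with `√B ≤ ε s` this contradicts `ε⁵ < √B`.
    have hnle : n ≤ |(q : ℤ) * (q * a ^ 2 - p * c ^ 2)| := by
      rw [← hpell, abs_mul, abs_of_pos (hn0.trans_le hsum)]
      exact hsum.trans (le_mul_of_one_le_left (hn0.le.trans hsum) hE)
    have hEle : |(q : ℝ) * (q * a ^ 2 - p * c ^ 2)| ≤ ε ^ 2 * ε ^ 2 := by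
      have ha1 : (1 : ℝ) ≤ (a : ℝ) ^ 2 := by
        have h0 : 0 < a ^ 2 := by positivity
        have : 1 ≤ a ^ 2 := by linarith
        exact_mod_cast this
      have hq0 : (0 : ℝ) ≤ q := Nat.cast_nonneg q
      have hpc : (0 : ℝ) ≤ p * c ^ 2 := by positivity
      have hqa : (0 : ℝ) ≤ q * a ^ 2 := by positivity
      rw [abs_mul, abs_of_nonneg hq0]
      refine mul_le_mul ((le_mul_of_one_le_right hq0 ha1).trans qa) (abs_le.2 ⟨by linarith, by linarith⟩) (abs_nonneg _)
        (by positivity)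
    have hnle' : (n : ℝ) ≤ ε ^ 4 := by
      have : (n : ℝ) ≤ |(q : ℝ) * (q * a ^ 2 - p * c ^ 2)| := by exact_mod_cast hnle
      calc (n : ℝ) ≤ _ := this
        _ ≤ ε ^ 2 * ε ^ 2 := hEle
        _ = ε ^ 4 := by ring
    have hsn' : (s : ℝ) ≤ n := by exact_mod_cast hsn.le
    have hc1 : (1 : ℝ) ≤ |(c : ℝ)| := by exact_mod_cast Int.one_le_abs hc
    have : √B ≤ ε ^ 5 := by
      calc √B ≤ √B * |(c : ℝ)| := le_mul_of_one_le_right (Real.sqrt_nonneg B) hc1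
        _ ≤ ε * s := kc
        _ ≤ ε * ε ^ 4 := by gcongr; linarith
        _ = ε ^ 5 := by ring
    linarith

lemma regionV_subset : regionV ⊆ specialCurvesᶜ := by
  rintro P ⟨T, h1, h2, rfl⟩ hP
  obtain ⟨i, hi⟩ := Set.mem_iUnion.1 hP
  have hi : affinePoint (![((T.1 : ℝ) : ℂ), ((T.2 : ℝ) : ℂ), ((T.1 : ℝ) : ℂ) * ((T.2 : ℝ) : ℂ),
    ((T.1 : ℝ) : ℂ) / ((T.2 : ℝ) : ℂ)] i) = affinePoint 1 := hi
  have hi := affinePoint_injective hi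
  have h3 : (T.1 : ℝ) = 1 ∨ (T.2 : ℝ) = 1 ∨ (T.1 : ℝ) * T.2 = 1 ∨ (T.1 : ℝ) / T.2 = 1 := by
    fin_cases i <;> simp only [Fin.zero_eta, Fin.mk_one, Fin.reduceFinMk, Matrix.cons_val] at hi
    · exact Or.inl (by exact_mod_cast hi)
    · exact Or.inr (Or.inl (by exact_mod_cast hi))
    · exact Or.inr (Or.inr (Or.inl (by exact_mod_cast hi)))
    · exact Or.inr (Or.inr (Or.inr (by exact_mod_cast hi)))
  rcases h3 with h | h | h | h
  · linarith
  · linarith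
  · nlinarith
  · rw [div_eq_one_iff_eq T.2.ne_zero] at h
    linarith

lemma norm_chart_of_mem_regionV {P : ℚˣ × ℚˣ} (h : orbitPoint P ∈ regionV) :
    ‖chart P‖ = ((P.2 : ℚ) : ℝ) - 1 := by
  rw [orbitPoint_mem_regionV_iff] at h
  have h1 : (1 : ℝ) < ((P.1 : ℚ) : ℝ) := by exact_mod_cast h.1
  have h2 : ((P.1 : ℚ) : ℝ) < ((P.2 : ℚ) : ℝ) := by exact_mod_cast h.2
  rw [Prod.norm_def, chart]
  simp only [Real.norm_eq_abs]
  rw [abs_of_pos (by linarith), abs_of_pos (by linarith), max_eq_right (by linarith)]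

lemma nodal_parametrization {a b : ℕ} {l : ℚ} (ha : 0 < a) (hab : a < b)
    (h1 : √((b : ℝ) / a) < (l : ℝ)) (h2 : (l : ℝ) < (b : ℝ) / a) :
    ∃ w z : ℚ, w = b * (l - 1) / (l * (b - l * a)) ∧ z = l * a * (l - 1) / (b - l * a) ∧
      1 < w ∧ w < z ∧ z - 1 = l * (w - 1) ∧ b * z = a * w * l ^ 2 ∧
      (z : ℝ) - 1 = ((l : ℝ) ^ 2 - (b : ℝ) / a) / ((b : ℝ) / a - l) := by
  have ha' : (0 : ℚ) < a := by exact_mod_cast ha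
  have hab' : (a : ℚ) < b := by exact_mod_cast hab
  have har : (0 : ℝ) < a := by exact_mod_cast ha
  have habr : (a : ℝ) < b := by exact_mod_cast hab
  have hl1 : (1 : ℝ) < l := by
    refine lt_of_le_of_lt ?_ h1
    rw [Real.one_le_sqrt, one_le_div har]
    exact habr.le
  have hl2 : (b : ℝ) < a * (l : ℝ) ^ 2 := by
    have := (Real.sqrt_lt' (by linarith)).1 h1
    rwa [div_lt_iff₀ har, mul_comm] at this
  have hl3 : (l : ℝ) * a < b := by rwa [lt_div_iff₀ har] at h2
  have l1 : 1 < l := by exact_mod_cast hl1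
  have l2 : (b : ℚ) < a * l ^ 2 := by exact_mod_cast hl2
  have l3 : l * a < b := by exact_mod_cast hl3
  have l0 : 0 < l := by linarith
  have d0 : 0 < b - l * a := by linarith
  have e1 : (b : ℚ) * (l - 1) / (l * (b - l * a)) = 1 + (a * l ^ 2 - b) / (l * (b - l * a)) := by
    field_simp
    ring
  have e2 : l * (a : ℚ) * (l - 1) / (b - l * a) = 1 + (a * l ^ 2 - b) / (b - l * a) := by
    field_simp
    ring
  have q1 : 0 < (a * l ^ 2 - b) / (l * (b - l * a)) := by
    have : 0 < a * l ^ 2 - b := by linarith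
    positivity
  have e3 : (a * l ^ 2 - b) / (b - l * a) = l * ((a * l ^ 2 - b) / (l * (b - l * a))) := by
    field_simp
  refine ⟨_, _, rfl, rfl, ?_, ?_, ?_, ?_, ?_⟩
  · rw [e1]
    linarith
  · rw [e1, e2, e3]
    nlinarith
  · rw [e1, e2, e3]
    ring
  · field_simp
  · have hd : (0 : ℝ) < b - l * a := by linarith
    have hd' : (0 : ℝ) < (b : ℝ) / a - l := by linarith
    rw [e2]
    push_cast
    field_simp
    ring

/-- The curve through `(w, z)` has `b/a = w l²/z =: c`, with `l` the slope to `Q`. The inequalities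
`l < c < l²` translate `1 < w < z`. -/
lemma exists_nodal_parameters {w z : ℚ} (w1 : 1 < w) (wz : w < z) :
    ∃ (a b : ℕ) (l : ℚ), 0 < a ∧ a < b ∧ a.Coprime b ∧ √((b : ℝ) / a) < (l : ℝ) ∧
      (l : ℝ) < (b : ℝ) / a ∧ z - 1 = l * (w - 1) ∧ b * z = a * w * l ^ 2 ∧
      b * z * (w - 1) ^ 2 = a * w * (z - 1) ^ 2 := by
  have hw1 : 0 < w - 1 := by linarith
  obtain ⟨l, hl⟩ : ∃ l : ℚ, z - 1 = l * (w - 1) := ⟨(z - 1) / (w - 1), by field_simp⟩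
  have hl1 : 1 < l := by
    by_contra! hle
    nlinarith
  have hz0 : 0 < z := by linarith
  have hw0 : 0 < w := by linarith
  obtain ⟨c, hc⟩ : ∃ c : ℚ, c = w * l ^ 2 / z := ⟨_, rfl⟩
  have hcz : c * z = w * l ^ 2 := by rw [hc]; field_simp
  have hlc : l < c := by
    have : 0 < (c - l) * z := by
      have : (c - l) * z = l * (l - 1) := by linear_combination hcz - l * hl
      rw [this]
      nlinarith
    linarith [pos_of_mul_pos_left this hz0.le]
  have hcl2 : c < l ^ 2 := by
    rw [hc, div_lt_iff₀ hz0, mul_comm]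
    gcongr
  have hc0 : 0 < c := by linarith
  have hcn : (c.num.toNat : ℤ) = c.num := Int.toNat_of_nonneg (Rat.num_nonneg.2 hc0.le)
  have hcq : (c.num.toNat : ℚ) = c * c.den := by
    rw [Rat.mul_den_eq_num]
    exact_mod_cast hcn
  have hden : (0 : ℚ) < c.den := by exact_mod_cast c.den_pos
  have hdiv : ((c.num.toNat : ℝ)) / c.den = (c : ℝ) := by
    rw [div_eq_iff (by exact_mod_cast c.den_nz)]
    exact_mod_cast hcq
  refine ⟨c.den, c.num.toNat, l, c.den_pos, ?_, ?_, ?_, ?_, hl, ?_, ?_⟩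
  · have : (c.den : ℚ) < c.num.toNat := by
      rw [hcq]
      nlinarith
    exact_mod_cast this
  · have := c.reduced.symm
    rwa [← hcn, Int.natAbs_natCast] at this
  · rw [hdiv]
    refine (Real.sqrt_lt' (by exact_mod_cast (by linarith : 0 < l))).2 ?_
    exact_mod_cast hcl2
  · rw [hdiv]
    exact_mod_cast hlc
  · rw [hcq]
    linear_combination (c.den : ℚ) * hcz
  · rw [hcq, hl]
    linear_combination (c.den : ℚ) * (w - 1) ^ 2 * hcz

/-- A point of `V` corresponds to its slope and the reduced fraction `b/a`. For large `B`,
`nodal_coefficients` places that fraction in `nodalPairs ε`, so the pairs outside it contribute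
nothing. -/
lemma zoomMeasure_regionV {ε B : ℝ} (hε : 0 < ε) (hB : ε < √B) (hB5 : ε ^ 5 < √B) :
    zoomMeasure regionV B 2 (Metric.closedBall 0 ε) =
      ∑' p : nodalPairs ε, ((nodalParams p.1.1 p.1.2 ε B 2).encard : ℝ≥0∞) := by
  rw [zoomMeasure_closedBall]
  simp only [← ENNReal.tsum_set_one]
  rw [← ENNReal.tsum_sigma (fun (p : nodalPairs ε) (_ : nodalParams p.1.1 p.1.2 ε B 2) =>
    (1 : ℝ≥0∞))]
  have hex : ∀ t : Σ p : nodalPairs ε, nodalParams p.1.1 p.1.2 ε B 2,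
      ∃ P : zoomPoints regionV ε B,
        ((P.1.2 : ℚ) - 1 = t.2.1 * ((P.1.1 : ℚ) - 1)) ∧ (1 < (P.1.1 : ℚ)) ∧
        (t.1.1.2 * (P.1.2 : ℚ) = t.1.1.1 * (P.1.1 : ℚ) * t.2.1 ^ 2) := by
    rintro ⟨⟨⟨a, b⟩, ha, hab, hbε, hcop, hsq⟩, l, h1, h2, h3, h4⟩
    obtain ⟨w, z, hw, hz, w1, wz, e1, e2, e3⟩ := nodal_parametrization ha hab h1 h2
    rw [← hw, ← hz] at h4
    have hmem : orbitPoint (Units.mk0 w (by linarith), Units.mk0 z (by linarith)) ∈ regionV := by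
      rw [orbitPoint_mem_regionV_iff]
      exact ⟨w1, wz⟩
    refine ⟨⟨(Units.mk0 w (by linarith), Units.mk0 z (by linarith)), hmem, h4, ?_⟩, e1, w1, e2⟩
    rw [norm_chart_of_mem_regionV hmem, Units.val_mk0, e3, Real.sqrt_eq_rpow]
    exact h3
  choose Ψ hΨ1 hΨ2 hΨ3 using hex
  have hbij : Function.Bijective Ψ := by
    constructor
    · rintro ⟨⟨⟨a, b⟩, hp⟩, l, hl⟩ ⟨⟨⟨a', b'⟩, hp'⟩, l', hl'⟩ h
      have i1 := hΨ1 ⟨⟨⟨a, b⟩, hp⟩, l, hl⟩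
      have i2 := hΨ2 ⟨⟨⟨a, b⟩, hp⟩, l, hl⟩
      have i3 := hΨ3 ⟨⟨⟨a, b⟩, hp⟩, l, hl⟩
      have j1 := hΨ1 ⟨⟨⟨a', b'⟩, hp'⟩, l', hl'⟩
      have j3 := hΨ3 ⟨⟨⟨a', b'⟩, hp'⟩, l', hl'⟩
      rw [← h] at j1 j3
      simp only [] at i1 i2 i3 j1 j3
      set w : ℚ := (Ψ ⟨⟨⟨a, b⟩, hp⟩, l, hl⟩).1.1.val
      set z : ℚ := (Ψ ⟨⟨⟨a, b⟩, hp⟩, l, hl⟩).1.2.val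
      have hw : w - 1 ≠ 0 := by linarith
      obtain rfl : l = l' := mul_right_cancel₀ hw (i1.symm.trans j1)
      have hz0 : z ≠ 0 := Units.ne_zero _
      have hab : a * b' = a' * b := by
        have : (a : ℚ) * b' = a' * b := by
          apply mul_right_cancel₀ hz0
          linear_combination a * j3 - a' * i3
        exact_mod_cast this
      have hcop : a.Coprime b := hp.2.2.2.1
      have hcop' : a'.Coprime b' := hp'.2.2.2.1
      obtain rfl : a = a' := Nat.dvd_antisymm
        (hcop.dvd_of_dvd_mul_right ⟨b', hab.symm⟩) (hcop'.dvd_of_dvd_mul_right ⟨b, hab⟩)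
      obtain rfl : b = b' := (Nat.eq_of_mul_eq_mul_left hp.1 hab).symm
      rfl
    · rintro ⟨P, hP⟩
      obtain ⟨w1, wz⟩ := (orbitPoint_mem_regionV_iff P).1 hP.1
      obtain ⟨a, b, l, ha, hab, hcop, hl1, hl2, e1, e2, e3⟩ := exists_nodal_parameters w1 wz
      obtain ⟨hb, hsq⟩ := nodal_coefficients hε hB hB5
        (P := P) ⟨regionV_subset hP.1, hP.2⟩ ha (ha.trans hab) hcop e3
      obtain ⟨w, z, hw, hz, w1', -, e1', e2', e4⟩ := nodal_parametrization ha hab hl1 hl2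
      have h2 : l * a < b := by
        have := (lt_div_iff₀ (by exact_mod_cast ha)).1 hl2
        exact_mod_cast this
      have h1 : 1 < l := by
        have : (l - 1) * ((P.1 : ℚ) - 1) = P.2 - P.1 := by linear_combination -e1
        by_contra! hle
        nlinarith
      have hd : (b : ℚ) - a * l ≠ 0 := by
        intro h0
        linarith
      -- For a given slope the nodal equation becomes linear after removing `Q`; the determinant of
      -- the resulting system is essentially `l(b - al)`, which is nonzero.
      have uniq : ∀ w z w' z' : ℚ, z - 1 = l * (w - 1) → b * z = a * w * l ^ 2 →
          z' - 1 = l * (w' - 1) → b * z' = a * w' * l ^ 2 → w = w' ∧ z = z' := by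
        intro w z w' z' i1 i2 j1 j2
        have : w = w' := by
          apply mul_left_cancel₀ (mul_ne_zero (by linarith : l ≠ 0) hd)
          linear_combination i2 - j2 - b * i1 + b * j1
        exact ⟨this, by rw [this] at i1; linarith⟩
      obtain ⟨rfl, rfl⟩ := uniq _ _ _ _ e1' e2' e1 e2
      have hH := hP.2.1
      rw [hw, hz] at hH
      have hd := hP.2.2
      rw [norm_chart_of_mem_regionV hP.1, e4, Real.sqrt_eq_rpow] at hd
      refine ⟨⟨⟨(a, b), ha, hab, hb, hcop, hsq⟩, l, hl1, hl2, hd, hH⟩, Subtype.ext ?_⟩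
      obtain ⟨u1, u2⟩ := uniq _ _ _ _ (hΨ1 ⟨⟨(a, b), ha, hab, hb, hcop, hsq⟩, l, hl1, hl2, hd, hH⟩)
        (hΨ3 ⟨⟨(a, b), ha, hab, hb, hcop, hsq⟩, l, hl1, hl2, hd, hH⟩) e1 e2
      exact Prod.ext (Units.ext u1) (Units.ext u2)
  exact ((Equiv.ofBijective Ψ hbij).tsum_eq fun _ => (1 : ℝ≥0∞)).symm

/-! ### The critical zoom has no limit measure -/

/-- The product `(m n₀ - m₀ n)(m n₀ + m₀ n) = n² - n₀²` is positive, so `m n₀ + m₀ n ≤ n² - n₀²`. If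
`n² ≤ 2n₀²` the right side is at most `n₀²`, too small because `m ≥ n > n₀`. -/
lemma pell_gap {m n m₀ n₀ : ℤ} (hm : 0 < m) (hm₀ : 0 < m₀) (hn₀ : 0 < n₀) (hn : n₀ < n)
    (h : m ^ 2 - 2 * n ^ 2 = -1) (h₀ : m₀ ^ 2 - 2 * n₀ ^ 2 = -1) : 2 * n₀ ^ 2 < n ^ 2 := by
  by_contra! hle
  have hn' : 0 < n := hn₀.trans hn
  have hk : (m * n₀ - m₀ * n) * (m * n₀ + m₀ * n) = n ^ 2 - n₀ ^ 2 := by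
    linear_combination n₀ ^ 2 * h - n ^ 2 * h₀
  have hs : 0 < m * n₀ + m₀ * n := by positivity
  have hd : 0 < n ^ 2 - n₀ ^ 2 := by nlinarith
  have hk1 : 0 < m * n₀ - m₀ * n := pos_of_mul_pos_left (hk ▸ hd) hs.le
  have hk2 : m * n₀ + m₀ * n ≤ n ^ 2 - n₀ ^ 2 := by
    rw [← hk]
    exact le_mul_of_one_le_left hs.le hk1
  have hmn : n ≤ m := by nlinarith
  nlinarith [mul_pos hm₀ hn']

/-- Here `√B = 2s + 3` is itself the `n₀` of a solution of `m² - 2n² = -1`. Radius `3/2` forces `|a|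
= |c| = 1` and `{p, q} = {1, 2}`, so a point would give another solution with `n > n₀`. Its height
forces `n² < 2n₀²`, inside the gap. -/
lemma zoomPoints_eq_empty {x s : ℕ} (h : (x + 1) * (x + 2) = 2 * ((s + 1) * (s + 2)))
    (hs : 1 ≤ s) : zoomPoints specialCurvesᶜ (3 / 2) ((2 * s + 3) ^ 2) = ∅ := by
  rw [Set.eq_empty_iff_forall_notMem]
  intro P hP
  have hsqrt : √((2 * (s : ℝ) + 3) ^ 2) = 2 * s + 3 := Real.sqrt_sq (by positivity)
  have hs1 : (1 : ℝ) ≤ s := by exact_mod_cast hs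
  obtain ⟨G, p, q, x', s', a, c, hG, hp, hq, hx, hs', hax, hcs, ew, ez, h1, h2, qa, pc, b1, b2,
    b3, b4, ka, kc, -⟩ := zoomPoints_data (by rw [hsqrt]; linarith) hP
  obtain ⟨ha, hc, hne⟩ := ne_of_notMem_specialCurves hP.1 hG hx hs' ew ez h1 h2
  rw [hsqrt] at ka kc
  have hpell : (q : ℤ) * (2 * x' + a) ^ 2 - p * (2 * s' + c) ^ 2 = q * a ^ 2 - p * c ^ 2 := by
    linear_combination 4 * (q : ℤ) * h1 - 4 * (p : ℤ) * h2
  have h₀ : (2 * (x : ℤ) + 3) ^ 2 - 2 * (2 * s + 3) ^ 2 = -1 := by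
    zify at h
    linear_combination 4 * h
  have small : ∀ (e : ℕ) (b : ℤ), 0 < e → b ≠ 0 → (e : ℝ) * b ^ 2 ≤ (3 / 2) ^ 2 →
      |b| = 1 ∧ (e = 1 ∨ e = 2) := by
    intro e b he hb hle
    have h1 : (e : ℤ) * b ^ 2 ≤ 2 := by
      have : (e : ℤ) * b ^ 2 < 3 := by
        have : (e : ℝ) * b ^ 2 < 3 := by linarith
        exact_mod_cast this
      omega
    have h2 := Int.one_le_abs hb
    have he' : (1 : ℤ) ≤ e := by exact_mod_cast he
    rw [← sq_abs] at h1
    have h3 : |b| < 2 := by nlinarith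
    have h4 : |b| = 1 := by omega
    rw [h4] at h1
    exact ⟨h4, by omega⟩
  have main : ∀ (y : ℕ) (b : ℤ) (m : ℤ), |b| = 1 → 0 < m →
      (2 * (s : ℝ) + 3) * |(b : ℝ)| ≤ 3 / 2 * y → (y : ℝ) ^ 2 * 2 ≤ (2 * s + 3) ^ 2 →
      ((y : ℝ) + b) ^ 2 * 2 ≤ (2 * s + 3) ^ 2 → m ^ 2 - 2 * (2 * y + b) ^ 2 ≠ -1 := by
    intro y b m hb hm k1 k2 k3 hmn
    have hb' : |(b : ℝ)| = 1 := by exact_mod_cast hb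
    rw [hb'] at k1
    -- From `y ≥ (2/3)(2s + 3)` one gets `2y - 1 > 2s + 3`, using `s ≥ 1`.
    have hn : (2 * (s : ℝ) + 3) < 2 * y + b := by
      have := (abs_le.1 hb'.le).1
      linarith
    have := pell_gap hm (by positivity) (by positivity) (by exact_mod_cast hn) hmn h₀
    have : 2 * (2 * (s : ℝ) + 3) ^ 2 < (2 * y + b) ^ 2 := by exact_mod_cast this
    -- The identity `(2y + b)² = 2y² + 2(y + b)² - b²` turns the two height bounds into an upper
    -- bound below the gap.
    nlinarith [sq_nonneg (b : ℝ)]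
  obtain ⟨ha1, hq1⟩ := small q a hq ha qa
  obtain ⟨hc1, hp1⟩ := small p c hp hc pc
  have ha2 : a ^ 2 = 1 := by rw [← sq_abs, ha1, one_pow]
  have hc2 : c ^ 2 = 1 := by rw [← sq_abs, hc1, one_pow]
  have hmx : 0 < 2 * (x' : ℤ) + a := by linarith [neg_abs_le a]
  have hms : 0 < 2 * (s' : ℤ) + c := by linarith [neg_abs_le c]
  rw [ha2, hc2] at hne hpell
  rcases hq1 with rfl | rfl <;> rcases hp1 with rfl | rfl
  · exact hne rfl
  · refine main s' c _ hc1 hmx kc (by exact_mod_cast b4) (by exact_mod_cast b3) ?_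
    push_cast at hpell
    linarith
  · refine main x' a _ ha1 hms ka (by exact_mod_cast b1) (by exact_mod_cast b2) ?_
    push_cast at hpell
    linarith
  · exact hne rfl

lemma exists_zoomMeasure_eq_zero (b : ℝ) : ∃ B, b ≤ B ∧
    zoomMeasure specialCurvesᶜ B 2 (Metric.closedBall 0 (3 / 2)) = 0 := by
  obtain ⟨s, x, hs, hx⟩ := exists_consecutive_products (N := 2) (e := 1) (r := 1) rfl le_rfl
    (⌈b⌉₊ + 2)
  obtain ⟨s, rfl⟩ : ∃ s', s = s' + 1 := ⟨s - 1, by omega⟩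
  obtain ⟨x, rfl⟩ : ∃ x', x = x' + 1 := ⟨x - 1, by
    have : x ≠ 0 := by rintro rfl; simp at hx
    omega⟩
  refine ⟨(2 * s + 3) ^ 2, ?_, ?_⟩
  · have h1 : b ≤ ⌈b⌉₊ := Nat.le_ceil b
    have h2 : (⌈b⌉₊ : ℝ) ≤ s := by exact_mod_cast (by omega : ⌈b⌉₊ ≤ s)
    nlinarith [(Nat.cast_nonneg s : (0 : ℝ) ≤ s)]
  · rw [zoomMeasure_closedBall, zoomPoints_eq_empty hx (by omega)]
    simp

/-- Taking `B = 2(s + 2)²`, the height bound of a Pell point, the rescaled norm is `√2(s + 2)/(s +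
1)`, which decreases to `√2`. -/
lemma exists_one_le_zoomMeasure {δ : ℝ} (hδ : 0 < δ) (b : ℝ) : ∃ B, b ≤ B ∧
    1 ≤ zoomMeasure regionV B 2 {v | √2 ≤ ‖v‖ ∧ ‖v‖ ≤ √2 + δ} := by
  obtain ⟨s, x, hs, hx⟩ := exists_consecutive_products (N := 2) (e := 1) (r := 1) rfl le_rfl
    (⌈b⌉₊ + ⌈√2 / δ⌉₊ + 1)
  obtain ⟨s, rfl⟩ : ∃ s', s = s' + 1 := ⟨s - 1, by omega⟩
  obtain ⟨x, rfl⟩ : ∃ x', x = x' + 1 := ⟨x - 1, by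
    have : x ≠ 0 := by rintro rfl; simp at hx
    omega⟩
  have hsx : s < x := by
    by_contra! hle
    nlinarith [Nat.mul_le_mul (Nat.add_le_add_right hle 1) (Nat.add_le_add_right hle 2)]
  obtain ⟨h1, h2⟩ := height_consecRatio hsx.le hx
  have b1 : b ≤ ⌈b⌉₊ := Nat.le_ceil b
  have b2 : √2 / δ ≤ ⌈√2 / δ⌉₊ := Nat.le_ceil _
  have b3 : (⌈b⌉₊ : ℝ) + ⌈√2 / δ⌉₊ ≤ s := by exact_mod_cast (by omega)
  have b4 : (0 : ℝ) ≤ ⌈b⌉₊ := Nat.cast_nonneg _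
  have b5 : (0 : ℝ) ≤ ⌈√2 / δ⌉₊ := Nat.cast_nonneg _
  have hs0 : (0 : ℝ) < s + 1 := by positivity
  refine ⟨2 * (s + 2) ^ 2, by nlinarith, ?_⟩
  have hmeas : MeasurableSet {v : ℝ × ℝ | √2 ≤ ‖v‖ ∧ ‖v‖ ≤ √2 + δ} :=
    (measurableSet_le measurable_const measurable_norm).inter
      (measurableSet_le measurable_norm measurable_const)
  rw [zoomMeasure_apply _ _ _ hmeas]
  have hmem : (consecRatio x, consecRatio s) ∈ {P : ℚˣ × ℚˣ | orbitPoint P ∈ regionV ∧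
      anticanonicalHeight P.1 P.2 ≤ 2 * (s + 2) ^ 2 ∧
      (2 * ((s : ℝ) + 2) ^ 2) ^ (1 / (2 : ℝ)) • chart P ∈
        {v : ℝ × ℝ | √2 ≤ ‖v‖ ∧ ‖v‖ ≤ √2 + δ}} := by
    refine ⟨?_, by exact_mod_cast h1, ?_⟩
    · rw [orbitPoint_mem_regionV_iff]
      have hsx' : (s : ℚ) < x := by exact_mod_cast hsx
      simp only [consecRatio, Units.val_mk0]
      push_cast
      constructor
      · rw [one_lt_div (by positivity)]
        linarith
      · rw [div_lt_div_iff₀ (by positivity) (by positivity)]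
        nlinarith
    · have : ‖(2 * ((s : ℝ) + 2) ^ 2) ^ (1 / (2 : ℝ)) • chart (consecRatio x, consecRatio s)‖ =
          √2 + √2 / (s + 1) := by
        rw [norm_smul, h2, ← Real.sqrt_eq_rpow, Real.sqrt_mul (by norm_num),
          Real.sqrt_sq (by positivity), Real.norm_of_nonneg (by positivity)]
        field_simp
        ring
      simp only [Set.mem_ofPred_eq]
      rw [this]
      constructor
      · have : 0 ≤ √2 / ((s : ℝ) + 1) := by positivity
        linarith
      · have : √2 / ((s : ℝ) + 1) ≤ δ := by
          rw [div_le_iff₀ hs0, mul_comm, ← div_le_iff₀ hδ]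
          linarith
        linarith
  have : (1 : ℕ∞) ≤ Set.encard _ := Set.one_le_encard_iff_nonempty.2 ⟨_, hmem⟩
  exact_mod_cast this

/-! ### From oscillating counts to the absence of a limit measure -/

lemma integrable_zoomMeasure {A : Set Y4} {B R : ℝ} {f : ℝ × ℝ → ℝ} (hf : Continuous f)
    (hsupp : ∀ v, v ∉ Metric.closedBall (0 : ℝ × ℝ) R → f v = 0) (hle : ∀ v, |f v| ≤ 1)
    (hfin : zoomMeasure A B 2 (Metric.closedBall 0 R) < ∞) :
    Integrable f (zoomMeasure A B 2) := by
  have hs : Function.support f ⊆ Metric.closedBall 0 R := fun v hv => by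
    by_contra h
    exact hv (hsupp v h)
  rw [← integrableOn_iff_integrable_of_support_subset hs]
  exact Measure.integrableOn_of_bounded hfin.ne hf.aestronglyMeasurable
    (Eventually.of_forall fun v => hle v)

lemma not_isLimitMeasure {A : Set Y4}
    (hfin : ∀ ε : ℝ, 0 < ε → ∃ C : ℝ≥0, ∀ B : ℝ, ε < √B →
      zoomMeasure A B 2 (Metric.closedBall 0 ε) ≤ C)
    (hzero : ∀ b : ℝ, ∃ B, b ≤ B ∧ zoomMeasure A B 2 (Metric.closedBall 0 (3 / 2)) = 0)
    (hone : ∀ δ : ℝ, 0 < δ → ∀ b : ℝ, ∃ B, b ≤ B ∧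
      1 ≤ zoomMeasure A B 2 {v | √2 ≤ ‖v‖ ∧ ‖v‖ ≤ √2 + δ}) (μ : Measure (ℝ × ℝ)) :
    ¬ IsLimitMeasure A 2 μ := by
  rintro ⟨hμ, hloc, γ, β, hγ, hβ, hlim⟩
  have hs := Real.tendsto_sqrt_atTop
  by_cases h0 : γ = 0 ∧ β = 0
  · obtain ⟨rfl, rfl⟩ := h0
    have h2 : √2 < 1.42 := by rw [Real.sqrt_lt' (by norm_num)]; norm_num
    have h2' : 1.41 < √2 := Real.lt_sqrt_of_sq_lt (by norm_num)
    -- A tent of half-width `1/20` around the norm `√2`, supported inside the ball of radius `3/2`.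
    -- Its integral is 0 for arbitrarily large `B` and at least `1/2` for others.
    set f : ℝ × ℝ → ℝ := fun v => max 0 (1 - 20 * |‖v‖ - √2|) with hf
    have hcont : Continuous f := by fun_prop
    have hsupp : ∀ v, v ∉ Metric.closedBall (0 : ℝ × ℝ) (3 / 2) → f v = 0 := by
      intro v hv
      rw [mem_closedBall_zero_iff, not_le] at hv
      apply max_eq_left
      have := le_abs_self (‖v‖ - √2)
      linarith
    have hnn : ∀ v, 0 ≤ f v := fun v => le_max_left _ _
    have hle : ∀ v, |f v| ≤ 1 := fun v => by
      rw [abs_of_nonneg (hnn v)]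
      exact max_le zero_le_one (by linarith [abs_nonneg (‖v‖ - √2)])
    have hl := hlim f hcont (HasCompactSupport.intro (isCompact_closedBall 0 (3 / 2)) hsupp)
    simp only [Real.rpow_zero, mul_one, div_one] at hl
    obtain ⟨C, hC⟩ := hfin (3 / 2) (by norm_num)
    obtain ⟨b, hb⟩ := eventually_atTop.1 ((hl.eventually (Metric.ball_mem_nhds _
      (by norm_num : (0 : ℝ) < 1 / 4))).and (hs.eventually_gt_atTop (3 / 2)))
    obtain ⟨B₀, hB₀, hz⟩ := hzero b
    obtain ⟨B₁, hB₁, ho⟩ := hone (1 / 40) (by norm_num) b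
    have i0 : ∫ v, f v ∂(zoomMeasure A B₀ 2) = 0 := by
      apply integral_eq_zero_of_ae
      refine measure_mono_null (fun v hv => ?_) hz
      by_contra h
      exact hv (hsupp v h)
    have hfin1 := (hC B₁ (hb B₁ hB₁).2).trans_lt ENNReal.coe_lt_top
    have i1 : 1 / 2 ≤ ∫ v, f v ∂(zoomMeasure A B₁ 2) := by
      have := mul_meas_ge_le_integral_of_nonneg (Eventually.of_forall hnn)
        (integrable_zoomMeasure hcont hsupp hle hfin1) (1 / 2)
      have hr : 1 ≤ (zoomMeasure A B₁ 2).real {v | 1 / 2 ≤ f v} := by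
        rw [measureReal_def, ← ENNReal.toReal_one]
        refine ENNReal.toReal_mono ((measure_mono fun v hv => ?_).trans_lt hfin1).ne
          (ho.trans (measure_mono ?_))
        · by_contra h
          simp only [Set.mem_ofPred_eq, hsupp v h] at hv
          norm_num at hv
        · rintro v ⟨hv1, hv2⟩
          change (1 : ℝ) / 2 ≤ max 0 (1 - 20 * |‖v‖ - √2|)
          refine le_max_of_le_right ?_
          have : |‖v‖ - √2| ≤ 1 / 40 := abs_le.2 ⟨by linarith, by linarith⟩
          linarith
      linarith
    have d0 := (hb B₀ hB₀).1
    have d1 := (hb B₁ hB₁).1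
    simp only [Real.dist_eq, i0, abs_lt] at d0 d1
    linarith [d0.1, d0.2, d1.1, d1.2]
  -- Here the normalization tends to infinity while the counts stay bounded, so `μ` vanishes on
  -- every ball.
  · have hden : Tendsto (fun B : ℝ => B ^ γ * Real.log B ^ β) atTop atTop := by
      rcases hγ.eq_or_lt with rfl | hγ
      · have hβ' : 0 < β := hβ.lt_of_ne fun h => h0 ⟨rfl, h.symm⟩
        simpa [Function.comp_def] using (tendsto_rpow_atTop hβ').comp Real.tendsto_log_atTop
      · refine tendsto_atTop_mono' _ ?_ (tendsto_rpow_atTop hγ)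
        filter_upwards [Real.tendsto_log_atTop.eventually_ge_atTop 1, eventually_ge_atTop 0]
          with B h1 h2
        exact le_mul_of_one_le_right (Real.rpow_nonneg h2 _) (Real.one_le_rpow h1 hβ)
    apply hμ
    rw [← Measure.measure_univ_eq_zero, ← Metric.iUnion_closedBall_nat (0 : ℝ × ℝ)]
    refine measure_iUnion_null fun R => ?_
    set f : ℝ × ℝ → ℝ := fun v => max 0 (min 1 (R + 1 - ‖v‖)) with hf
    have hcont : Continuous f := by fun_prop
    have hsupp : ∀ v, v ∉ Metric.closedBall (0 : ℝ × ℝ) (R + 1) → f v = 0 := by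
      intro v hv
      rw [mem_closedBall_zero_iff, not_le] at hv
      exact max_eq_left ((min_le_right _ _).trans (by linarith))
    have hnn : ∀ v, 0 ≤ f v := fun v => le_max_left _ _
    have hle : ∀ v, |f v| ≤ 1 := fun v => by
      rw [abs_of_nonneg (hnn v)]
      exact max_le zero_le_one (min_le_left _ _)
    have hcs : HasCompactSupport f :=
      HasCompactSupport.intro (isCompact_closedBall 0 ((R : ℝ) + 1)) hsupp
    have hl := hlim f hcont hcs
    obtain ⟨C, hC⟩ := hfin (R + 1) (by positivity)
    have hl0 : Tendsto (fun B : ℝ => (∫ y, f y ∂(zoomMeasure A B 2)) / (B ^ γ * Real.log B ^ β))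
        atTop (𝓝 0) := by
      refine tendsto_of_tendsto_of_tendsto_of_le_of_le' tendsto_const_nhds
        (hden.const_div_atTop (C : ℝ)) ?_ ?_
      · filter_upwards [hden.eventually_ge_atTop 0] with B hB
        exact div_nonneg (integral_nonneg hnn) hB
      · filter_upwards [hden.eventually_ge_atTop 0, hs.eventually_gt_atTop ((R : ℝ) + 1)]
          with B hB hB'
        have hfB := (hC B hB').trans_lt ENNReal.coe_lt_top
        gcongr
        rw [← setIntegral_eq_integral_of_forall_compl_eq_zero hsupp]
        have hnorm := norm_setIntegral_le_of_norm_le_const (f := f) hfB (fun v _ => hle v)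
        refine (le_abs_self _).trans (hnorm.trans ?_)
        rw [one_mul, measureReal_def]
        exact ENNReal.toReal_le_coe_of_le_coe (hC B hB')
    have hint := tendsto_nhds_unique hl hl0
    have hmeas := mul_meas_ge_le_integral_of_nonneg (Eventually.of_forall hnn)
      (hcont.integrable_of_hasCompactSupport hcs (μ := μ)) 1
    rw [hint, one_mul] at hmeas
    have hsub : Metric.closedBall (0 : ℝ × ℝ) R ⊆ {v | 1 ≤ f v} := fun v hv => by
      rw [mem_closedBall_zero_iff] at hv
      have hv' : (1 : ℝ) ≤ R + 1 - ‖v‖ := by linarith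
      exact le_max_of_le_right (le_min le_rfl hv')
    have hfinite : μ {v | 1 ≤ f v} ≠ ∞ := by
      refine ((measure_mono (t := Metric.closedBall 0 ((R : ℝ) + 1)) fun v hv => ?_).trans_lt
        (isCompact_closedBall _ _).measure_lt_top).ne
      by_contra h
      simp only [Set.mem_ofPred_eq, hsupp v h] at hv
      norm_num at hv
    refine measure_mono_null hsub ?_
    have := le_antisymm hmeas measureReal_nonneg
    rwa [measureReal_eq_zero_iff hfinite] at this

lemma zoomMeasure_closedBall_le {A : Set Y4} (hA : A ⊆ specialCurvesᶜ) {ε : ℝ} (hε : 0 < ε) :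
    ∃ C : ℝ≥0, ∀ B : ℝ, ε < √B → zoomMeasure A B 2 (Metric.closedBall 0 ε) ≤ C := by
  obtain ⟨C, hC⟩ := encard_zoomPoints_compl_le hε
  refine ⟨C, fun B hB => (zoomMeasure_mono hA B ε).trans ?_⟩
  rw [zoomMeasure_closedBall]
  have : ((zoomPoints specialCurvesᶜ ε B).encard : ℝ≥0∞) ≤ ((C : ℕ∞) : ℝ≥0∞) := by
    exact_mod_cast hC B hB
  exact this.trans_eq (by simp)

/-! ### Assembly of the theorem -/

theorem mainTheorem2 :
    -- the zoom of factor 2 is the critical one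
    essentialConst = 2 ∧
    -- only finitely many nodal curves contribute, and the count is bounded
    (∀ ε : ℝ, 0 < ε → ∃ (C : ℝ≥0) (B₀ : ℝ), ∀ B : ℝ, B₀ ≤ B →
      zoomMeasure regionV B 2 (Metric.closedBall 0 ε) =
        ∑' p : nodalPairs ε, ((nodalParams p.1.1 p.1.2 ε B 2).encard : ℝ≥0∞) ∧
      zoomMeasure regionV B 2 (Metric.closedBall 0 ε) ≤ C ∧
      zoomMeasure specialCurvesᶜ B 2 (Metric.closedBall 0 ε) ≤ C) ∧
    -- the union of the special curves is the smallest locally weakly accumulating subvariety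
    IsLocallyWeaklyAccumulating specialCurves ∧
    (∀ W : Set Y4, IsLocallyWeaklyAccumulating W → specialCurves ⊆ W) ∧
    -- there is no limit measure for the critical zoom
    (∀ A : Set Y4, A = regionV ∨ A = specialCurvesᶜ →
      (∃ η ε : ℝ, 0 < η ∧ η < ε ∧
        liminf (fun B : ℝ => zoomMeasure A B 2 (annulus η ε)) atTop = 0 ∧
        1 ≤ limsup (fun B : ℝ => zoomMeasure A B 2 (annulus η ε)) atTop ∧
        limsup (fun B : ℝ => zoomMeasure A B 2 (annulus η ε)) atTop < ∞) ∧
      ¬ ∃ μ : Measure (ℝ × ℝ), IsLimitMeasure A 2 μ) := by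
  have hs := Real.tendsto_sqrt_atTop
  refine ⟨essentialConst_eq, fun ε hε => ?_, isLocallyWeaklyAccumulating_specialCurves,
    fun W hW => specialCurves_subset_of_isLocallyWeaklyAccumulating hW, fun A hA => ?_⟩
  · obtain ⟨C, hC⟩ := zoomMeasure_closedBall_le subset_rfl hε
    obtain ⟨B₀, hB₀⟩ := eventually_atTop.1
      ((hs.eventually_gt_atTop ε).and (hs.eventually_gt_atTop (ε ^ 5)))
    exact ⟨C, B₀, fun B hB => ⟨zoomMeasure_regionV hε (hB₀ B hB).1 (hB₀ B hB).2,
      (zoomMeasure_mono regionV_subset B ε).trans (hC B (hB₀ B hB).1), hC B (hB₀ B hB).1⟩⟩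
  -- Both sets lie between `V` and `U₀`: emptiness passes down from `U₀` and points near norm `√2`
  -- pass up from `V`.
  · have hV : regionV ⊆ A := by
      rcases hA with rfl | rfl
      · exact subset_rfl
      · exact regionV_subset
    have hU : A ⊆ specialCurvesᶜ := by
      rcases hA with rfl | rfl
      · exact regionV_subset
      · exact subset_rfl
    have hfin := fun (ε : ℝ) (hε : 0 < ε) => zoomMeasure_closedBall_le hU hε
    have hzero : ∀ b : ℝ, ∃ B, b ≤ B ∧ zoomMeasure A B 2 (Metric.closedBall 0 (3 / 2)) = 0 := by
      intro b
      obtain ⟨B, hB, h⟩ := exists_zoomMeasure_eq_zero b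
      exact ⟨B, hB, le_antisymm ((zoomMeasure_mono hU B _).trans h.le) zero_le⟩
    have hone : ∀ δ : ℝ, 0 < δ → ∀ b : ℝ, ∃ B, b ≤ B ∧
        1 ≤ zoomMeasure A B 2 {v | √2 ≤ ‖v‖ ∧ ‖v‖ ≤ √2 + δ} := by
      intro δ hδ b
      obtain ⟨B, hB, h⟩ := exists_one_le_zoomMeasure hδ b
      have hmeas : MeasurableSet {v : ℝ × ℝ | √2 ≤ ‖v‖ ∧ ‖v‖ ≤ √2 + δ} :=
        (measurableSet_le measurable_const measurable_norm).inter
          (measurableSet_le measurable_norm measurable_const)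
      refine ⟨B, hB, h.trans ?_⟩
      rw [zoomMeasure_apply _ _ _ hmeas, zoomMeasure_apply _ _ _ hmeas]
      have hle := Set.encard_le_encard (s := {P : ℚˣ × ℚˣ | orbitPoint P ∈ regionV ∧
        anticanonicalHeight P.1 P.2 ≤ B ∧ B ^ (1 / (2 : ℝ)) • chart P ∈
          {v : ℝ × ℝ | √2 ≤ ‖v‖ ∧ ‖v‖ ≤ √2 + δ}}) fun P hP => And.intro (hV hP.1) hP.2
      exact_mod_cast hle
    have hsub : annulus 1 (3 / 2) ⊆ Metric.closedBall (0 : ℝ × ℝ) (3 / 2) := fun v hv => by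
      rw [mem_closedBall_zero_iff]
      exact hv.2
    -- The annulus is contained in the ball that is empty infinitely often and contains the norms
    -- just above `√2`.
    refine ⟨⟨1, 3 / 2, one_pos, by norm_num, ?_, ?_, ?_⟩, fun ⟨μ, hμ⟩ =>
      not_isLimitMeasure hfin hzero hone μ hμ⟩
    · refine le_antisymm (liminf_le_of_frequently_le ?_) zero_le
      refine frequently_atTop.2 fun b => ?_
      obtain ⟨B, hB, h⟩ := hzero b
      exact ⟨B, hB, (measure_mono hsub).trans h.le⟩
    · refine le_limsup_of_frequently_le ?_
      refine frequently_atTop.2 fun b => ?_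
      obtain ⟨B, hB, h⟩ := hone (1 / 20) (by norm_num) b
      have h2 : √2 < 1.42 := by rw [Real.sqrt_lt' (by norm_num)]; norm_num
      have h2' : 1.41 < √2 := Real.lt_sqrt_of_sq_lt (by norm_num)
      exact ⟨B, hB, h.trans (measure_mono fun v hv =>
        ⟨by linarith [hv.1], by linarith [hv.2]⟩)⟩
    · obtain ⟨C, hC⟩ := hfin (3 / 2) (by norm_num)
      refine lt_of_le_of_lt (b := (C : ℝ≥0∞)) (limsup_le_of_le (h := ?_)) ENNReal.coe_lt_top
      filter_upwards [hs.eventually_gt_atTop (3 / 2)] with B hB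
      exact (measure_mono hsub).trans (hC B hB)
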